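/- Let $S$ be an integrally closed Noetherian domain with fraction field $L$, let $p$ be a prime integer that is a non-zero prime element of $S$, and let $f_1,\dots,f_r\in S$ be non-zero non-units. Assume: (1) each $f_i$ is square-free, i.e. $f_iS_Q=QS_Q$ for every height one prime $Q$ of $S$ containing $f_i$; (2) the $f_i$ form a class one tower, i.e. for $i\neq j$ no height one prime of $S$ contains both $f_i$ and $f_j$, and each $f_i$ is a $p$-th power modulo $p^2S$. Let $\omega_1,\dots,\omega_r$ be elements of some field extension of $L$ with $\omega_i^p=f_i$, put $K=L(\omega_1,\dots,\omega_r)$, and let $R$ be the integral closure of $S$ in $K$. Then: (a) $R$ is a free $S$-module. (b) If $p$ is odd and $h_1,\dots,h_r\in S$ are any elements with $f_i\equiv h_i^p \bmod p^2S$ for all $i$, then $R$ is the $S$-span in $K$ of the elements $$p^{-k}\prod_{i=1}^r(\omega_i-h_i)^{j_i},\qquad 0\le j_i\le p-1,\quad k\ge 0,\quad (p-1)k\le \sum_{i=1}^r j_i<(p-1)(k+1).$$ (c) If $S$ is Cohen–Macaulay, or if $S$ is an unramified regular local ring of mixed characteristic $p$ (a regular local ring $(S,\mathfrak m)$ of characteristic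 zero with residue characteristic $p$ and $p\notin\mathfrak m^2$), then $R$ is Cohen–Macaulay. -/

import Mathlib

/-- An element `f` of a domain `S` is *square-free* if `f S_Q = Q S_Q` for every height one
prime `Q` of `S` containing `f`. -/
def IsSquareFreeElement {S : Type*} [CommRing S] (f : S) : Prop :=
  ∀ (Q : Ideal S) [Q.IsPrime], Q.height = 1 → f ∈ Q →
    Ideal.map (algebraMap S (Localization.AtPrime Q)) (Ideal.span {f}) =
      Ideal.map (algebraMap S (Localization.AtPrime Q)) Q

/-- The elements `f i`, `i : Fin r`, define a *class one tower* (for the prime `p`): no two of them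
lie in a common height one prime, and each of them is a `p`-th power modulo `p ^ 2`. -/
structure IsClassOneTower {S : Type*} [CommRing S] (p : ℕ) {r : ℕ} (f : Fin r → S) : Prop where
  no_common_heightOne_prime : ∀ i j : Fin r, i ≠ j →
    ∀ Q : Ideal S, Q.IsPrime → Q.height = 1 → ¬ (f i ∈ Q ∧ f j ∈ Q)
  isPow_mod_sq : ∀ i : Fin r, ∃ h : S, f i - h ^ p ∈ Ideal.span {(p : S) ^ 2}

/-- The depth of a local ring: the supremum of the lengths of the regular sequences
in its maximal ideal. -/
noncomputable def localRingDepth (A : Type*) [CommRing A] [IsLocalRing A] : ℕ∞ :=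
  ⨆ rs : {rs : List A // (∀ x ∈ rs, x ∈ IsLocalRing.maximalIdeal A) ∧
    RingTheory.Sequence.IsRegular A rs}, (rs.1.length : ℕ∞)

/-- A local ring is *Cohen-Macaulay* if it is Noetherian and its depth equals its Krull
dimension. -/
structure IsCohenMacaulayLocalRing (A : Type*) [CommRing A] [IsLocalRing A] : Prop where
  isNoetherianRing : IsNoetherianRing A
  depth_eq_dim : ((localRingDepth A : ℕ∞) : WithBot ℕ∞) = ringKrullDim A

/-- A commutative ring is *Cohen-Macaulay* if it is Noetherian and all its localizations at maximal
ideals are Cohen-Macaulay local rings. -/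
structure IsCohenMacaulayRing (A : Type*) [CommRing A] : Prop where
  isNoetherianRing : IsNoetherianRing A
  localization_maximal : ∀ (m : Ideal A) [m.IsMaximal],
    IsCohenMacaulayLocalRing (Localization.AtPrime m)

/-- An *unramified regular local ring of mixed characteristic `p`*: a regular local ring of
characteristic zero with residue characteristic `p` such that `p ∉ m ^ 2`. -/
structure IsUnramifiedRegularLocalRing (S : Type*) [CommRing S] (p : ℕ) : Prop
    extends IsRegularLocalRing S where
  charZero : CharZero S
  charP_residueField : CharP (IsLocalRing.ResidueField S) p
  notMem_sq : (p : S) ∉ IsLocalRing.maximalIdeal S ^ 2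

/-- The field `L(ω₁, …, ω_r)` inside an extension `E` of `L`. -/
abbrev radicalTower (L : Type*) {E : Type*} [Field L] [Field E] [Algebra L E] {r : ℕ}
    (ω : Fin r → E) : IntermediateField L E :=
  IntermediateField.adjoin L (Set.range ω)

/-- `ω_i` as an element of `L(ω₁, …, ω_r)`. -/
def radicalTowerRoot (L : Type*) {E : Type*} [Field L] [Field E] [Algebra L E] {r : ℕ}
    (ω : Fin r → E) (i : Fin r) : radicalTower L ω :=
  ⟨ω i, IntermediateField.subset_adjoin L (Set.range ω) (Set.mem_range_self i)⟩

/-- The elements `p ^ (-k) * ∏ i, (ω_i - h_i) ^ j_i` of `L(ω₁, …, ω_r)`, where `0 ≤ j_i ≤ p - 1`,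
`0 ≤ k` and `(p - 1) k ≤ ∑ i, j_i < (p - 1) (k + 1)`. -/
def radicalTowerGenerators (S L : Type*) {E : Type*} [CommRing S] [Field L] [Field E] [Algebra S L]
    [Algebra L E] (p : ℕ) {r : ℕ} (ω : Fin r → E) (h : Fin r → S) : Set (radicalTower L ω) :=
  {x | ∃ (j : Fin r → ℕ) (k : ℕ), (∀ i, j i ≤ p - 1) ∧
    (p - 1) * k ≤ ∑ i, j i ∧ ∑ i, j i < (p - 1) * (k + 1) ∧
    x = ((p : radicalTower L ω) ^ k)⁻¹ *
      ∏ i, (radicalTowerRoot L ω i - algebraMap L (radicalTower L ω) (algebraMap S L (h i))) ^ j i}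

open IsLocalRing RingTheory.Sequence

/-! ### Cohen–Macaulay rings and flat integral extensions -/

section CohenMacaulay

/-! The integral closure is computed with the trace form. The quotient of two distinct monomials
`ω^j`, `0 ≤ j_i < p`, has a `p`-th power that is not a `p`-th power in `L` (compare valuations at
height one primes containing the `f i`), so its trace is zero. Hence these monomials form an
`L`-basis of `K`, orthogonal up to inversion, and `[K : L] = p^r`.

Let `x` be integral and `y = Tr(x / ω^j)`. Conjugates of `ω^j` differ by roots of unity, so `y ω^j`
is integral and `y^p ∏ f_i^{j_i}` lies in `S`; since the `f i` are square-free, share no height one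
prime, and `j_i < p`, already `y ∈ S` (`IsClassOneTower.mem_range_of_pow_mul_prod_mem_range`). So
`p^r x ∈ S[ω]`, and only powers of `p` can occur as denominators.

To bound them, adjoin `l` with `l^(p-1) = p`. The congruence modulo `p^2` makes every `(ω_i - h_i) /
l` integral, which gives integrality of the proposed generators. Conversely, the dual basis of the
powers of `ω_i - h_i` is controlled by the same `l` (`isIntegral_sum_choose_mul_inv`). Taking a
power that returns to `S`, and using `p ∤ f_i`, shows that the coefficient of `∏ (ω_i - h_i)^{k_i}`
has denominator at most `p^⌊∑ k_i / (p-1)⌋` (`pow_dvd_shiftedCoeff_mul`). Thus these `p^r` elements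
span the integral closure, and by counting they are a basis.

Being free, `R` is flat and integral over `S`, so maximal regular sequences of the localizations of
`S` stay maximal in `R`. A regular local ring is Cohen–Macaulay by induction on dimension. -/

theorem localRingDepth_le_ringKrullDim (A : Type*) [CommRing A] [IsLocalRing A]
    [IsNoetherianRing A] : ((localRingDepth A : ℕ∞) : WithBot ℕ∞) ≤ ringKrullDim A := by
  obtain ⟨d, hd⟩ : ∃ d : ℕ∞, ringKrullDim A = (d : WithBot ℕ∞) :=
    ⟨_, (WithBot.coe_unbot _ ringKrullDim_ne_bot).symm⟩
  rw [hd, WithBot.coe_le_coe, localRingDepth]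
  refine iSup_le fun ⟨rs, _, hreg⟩ => ?_
  have h := ringKrullDim_add_length_eq_ringKrullDim_of_isRegular rs hreg
  have hnt : Nontrivial (A ⧸ Ideal.ofList rs) := by
    refine Ideal.Quotient.nontrivial_iff.mpr fun htop => hreg.top_ne_smul ?_
    rw [htop]; simp
  have h0 : (0 : WithBot ℕ∞) ≤ ringKrullDim (A ⧸ Ideal.ofList rs) := ringKrullDim_nonneg_of_nontrivial
  have h1 : ((rs.length : ℕ∞) : WithBot ℕ∞) ≤ (d : WithBot ℕ∞) := by
    rw [← hd, ← h]
    exact le_add_of_nonneg_left h0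
  exact WithBot.coe_le_coe.mp h1

theorem IsCohenMacaulayLocalRing.of_isRegular {A : Type*} [CommRing A] [IsLocalRing A]
    [IsNoetherianRing A] (rs : List A) (hmem : ∀ x ∈ rs, x ∈ maximalIdeal A)
    (hreg : IsRegular A rs) (hdim : ringKrullDim A ≤ rs.length) :
    IsCohenMacaulayLocalRing A := by
  refine ⟨inferInstance, le_antisymm (localRingDepth_le_ringKrullDim A) (hdim.trans ?_)⟩
  have : (rs.length : ℕ∞) ≤ localRingDepth A :=
    le_iSup (fun rs : {rs : List A // (∀ x ∈ rs, x ∈ maximalIdeal A) ∧ IsRegular A rs} =>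
      (rs.1.length : ℕ∞)) ⟨rs, hmem, hreg⟩
  exact_mod_cast WithBot.coe_le_coe.mpr this

theorem IsCohenMacaulayLocalRing.exists_isRegular {A : Type*} [CommRing A] [IsLocalRing A]
    (hA : IsCohenMacaulayLocalRing A) :
    ∃ rs : List A, (∀ x ∈ rs, x ∈ maximalIdeal A) ∧ IsRegular A rs ∧
      ringKrullDim A = rs.length := by
  have := hA.isNoetherianRing
  have hfin : localRingDepth A ≠ ⊤ := by
    intro h
    have h' := hA.depth_eq_dim
    rw [h] at h'
    exact ringKrullDim_ne_top h'.symm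
  obtain ⟨n, hn⟩ := ENat.ne_top_iff_exists.mp hfin
  have hne : Nonempty {rs : List A // (∀ x ∈ rs, x ∈ maximalIdeal A) ∧ IsRegular A rs} :=
    ⟨⟨[], by simp, IsRegular.nil A A⟩⟩
  -- A finite supremum in `ℕ∞` is attained; finiteness comes from the finite dimension of a
  -- Noetherian local ring.
  obtain ⟨⟨rs, h1, h2⟩, h3⟩ := ENat.exists_eq_iSup_of_lt_top
    (f := fun rs : {rs : List A // (∀ x ∈ rs, x ∈ maximalIdeal A) ∧ IsRegular A rs} =>
      (rs.1.length : ℕ∞)) (lt_top_iff_ne_top.mpr hfin)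
  refine ⟨rs, h1, h2, ?_⟩
  rw [← hA.depth_eq_dim, localRingDepth, ← h3]
  rfl

/-- Incomparability: contraction along an integral extension is strictly monotone on primes, so
chains keep their length. -/
theorem Ideal.height_le_height_under_of_isIntegral {S R : Type*} [CommRing S] [CommRing R]
    [Algebra S R] [Algebra.IsIntegral S R] (P : Ideal R) [P.IsPrime] :
    P.height ≤ (P.under S).height := by
  have hmono : StrictMono (PrimeSpectrum.comap (algebraMap S R)) := by
    intro I J hIJ
    exact Ideal.IsIntegral.comap_lt_comap (R := S) hIJ
  have h := Order.height_le_height_apply_of_strictMono _ hmono ⟨P, inferInstance⟩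
  rwa [← PrimeSpectrum.height_eq_orderHeight, ← PrimeSpectrum.height_eq_orderHeight] at h

/-- Flatness carries a maximal regular sequence of `S_m` to `R_n`, and the height bound shows that
it is already long enough there. -/
theorem IsCohenMacaulayRing.of_flat_of_isIntegral {S R : Type*} [CommRing S] [CommRing R]
    [Algebra S R] [IsNoetherianRing R] [Module.Flat S R] [Algebra.IsIntegral S R]
    (h : ∀ (m : Ideal S) [m.IsMaximal], IsCohenMacaulayLocalRing (Localization.AtPrime m)) :
    IsCohenMacaulayRing R := by
  refine ⟨inferInstance, fun n hn => ?_⟩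
  let m := n.under S
  have hm : m.IsMaximal := Ideal.isMaximal_comap_of_isIntegral_of_isMaximal (R := S) n
  have : n.LiesOver m := ⟨rfl⟩
  let := Localization.AtPrime.algebraOfLiesOver m n
  obtain ⟨rs, hmem, hreg, hdim⟩ := (h m).exists_isRegular
  have hmem' : ∀ x ∈ rs.map (algebraMap (Localization.AtPrime m) (Localization.AtPrime n)),
      x ∈ maximalIdeal (Localization.AtPrime n) := by
    intro x hx
    obtain ⟨y, hy, rfl⟩ := List.mem_map.mp hx
    have hy := hmem y hy
    rw [mem_maximalIdeal, mem_nonunits_iff] at hy ⊢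
    exact fun hu => hy (isUnit_of_map_unit _ _ hu)
  refine .of_isRegular (rs.map (algebraMap (Localization.AtPrime m) (Localization.AtPrime n)))
    hmem' (.of_isWeaklyRegular_of_mem_maximalIdeal _ hmem' hreg.toIsWeaklyRegular.of_flat) ?_
  rw [List.length_map, ← hdim, IsLocalization.AtPrime.ringKrullDim_eq_height n,
    IsLocalization.AtPrime.ringKrullDim_eq_height m]
  exact WithBot.coe_le_coe.mpr n.height_le_height_under_of_isIntegral

end CohenMacaulay

/-! ### Regular local rings are Cohen–Macaulay -/

section RegularLocal

/-- A Noetherian local ring with a principal prime ideal that is not a minimal prime is a domain. -/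
theorem isDomain_of_isPrime_span_singleton {A : Type*} [CommRing A] [IsLocalRing A]
    [IsNoetherianRing A] {x : A} (hx : x ∈ maximalIdeal A) (hprime : (Ideal.span {x}).IsPrime)
    (hmin : ∀ q ∈ minimalPrimes A, x ∉ q) : IsDomain A := by
  obtain ⟨q, hq, hqx⟩ := Ideal.exists_minimalPrimes_le (I := ⊥) (J := Ideal.span {x}) bot_le
  have hqp : q.IsPrime := hq.1.1
  have hxq : x ∉ q := hmin q hq
  -- If `b * x ∈ q` then `b ∈ q`, so `q = x q` and Nakayama applies.
  have hq0 : q = ⊥ := by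
    refine Submodule.eq_bot_of_le_smul_of_le_jacobson_bot (Ideal.span {x}) q
      (IsNoetherian.noetherian q) ?_ ?_
    · intro a ha
      obtain ⟨b, rfl⟩ := Ideal.mem_span_singleton'.mp (hqx ha)
      rw [mul_comm]
      exact Submodule.smul_mem_smul (Ideal.mem_span_singleton_self x)
        ((hqp.mem_or_mem ha).resolve_right hxq)
    · rw [IsLocalRing.jacobson_eq_maximalIdeal _ bot_ne_top]
      exact (Ideal.span_singleton_le_iff_mem _).mpr hx
  subst hq0
  exact IsDomain.of_bot_isPrime A

/-- An element outside `m ^ 2` can replace a member of a finite generating set of `m`. -/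
theorem exists_span_insert_eq_maximalIdeal {A : Type*} [CommRing A] [IsLocalRing A] {d : ℕ}
    {s : Finset A} (hs : Ideal.span (s : Set A) = maximalIdeal A) (hcard : s.card ≤ d + 1) {x : A}
    (hx : x ∈ maximalIdeal A) (hx2 : x ∉ maximalIdeal A ^ 2) :
    ∃ t : Finset A, t.card ≤ d ∧ (t : Set A) ⊆ maximalIdeal A ∧
      maximalIdeal A ≤ Ideal.span {x} ⊔ Ideal.span (t : Set A) := by
  classical
  have hsub : (s : Set A) ⊆ maximalIdeal A := hs ▸ Ideal.subset_span
  rw [← hs] at hx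
  obtain ⟨a, ha⟩ := Submodule.mem_span_finset'.mp hx
  -- If no coefficient were a unit, all would lie in `m` and `x` in `m ^ 2`; the generator with unit
  -- coefficient is the one exchanged for `x`.
  obtain ⟨g, hg⟩ : ∃ g : s, IsUnit (a g) := by
    by_contra! hcon
    refine hx2 (ha ▸ Ideal.sum_mem _ fun g _ => ?_)
    rw [pow_two, smul_eq_mul]
    exact Ideal.mul_mem_mul (hcon g) (hs ▸ Ideal.subset_span g.2)
  refine ⟨s.erase g, by rw [Finset.card_erase_of_mem g.2]; omega,
    fun y hy => hsub (Finset.mem_of_mem_erase hy), ?_⟩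
  rw [← hs, Ideal.span_le]
  have hother : ∀ y ∈ s, y ≠ g → y ∈ Ideal.span {x} ⊔ Ideal.span ((s.erase g : Finset A) : Set A) :=
    fun y hy hyg => Ideal.mem_sup_right (Ideal.subset_span (Finset.mem_coe.mpr
      (Finset.mem_erase.mpr ⟨hyg, hy⟩)))
  intro y hy
  by_cases hyg : y = g
  · subst hyg
    rw [SetLike.mem_coe, ← Ideal.unit_mul_mem_iff_mem _ hg]
    have h1 : a g * (g : A) = x - ∑ i ∈ Finset.univ.erase g, a i • (i : A) := by
      rw [← ha, ← Finset.add_sum_erase _ _ (Finset.mem_univ g)]; simp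
    rw [h1]
    refine sub_mem (Ideal.mem_sup_left (Ideal.mem_span_singleton_self x))
      (Ideal.sum_mem _ fun i hi => Submodule.smul_mem _ _ (hother i i.2 fun h => ?_))
    exact (Finset.mem_erase.mp hi).1 (Subtype.ext h)
  · exact hother y hy hyg

theorem exists_mem_maximalIdeal_notMem_sq_notMem_minimalPrimes {A : Type*} [CommRing A]
    [IsLocalRing A] [IsNoetherianRing A] (hdim : ringKrullDim A ≠ 0) :
    ∃ x ∈ maximalIdeal A, x ∉ maximalIdeal A ^ 2 ∧ ∀ q ∈ minimalPrimes A, x ∉ q := by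
  have hm : maximalIdeal A ∉ minimalPrimes A := fun h => hdim (by
    rw [← maximalIdeal_height_eq_ringKrullDim, Ideal.height_eq_zero_iff.mpr h]; rfl)
  have hfin := minimalPrimes.finite_of_isNoetherianRing A
  by_contra! hcon
  have hsub : (maximalIdeal A : Set A) ⊆
      ⋃ I ∈ insert (maximalIdeal A ^ 2) (minimalPrimes A), (I : Set A) := by
    intro x hx
    rw [Set.biUnion_insert]
    by_cases h2 : x ∈ maximalIdeal A ^ 2
    · exact Or.inl h2
    · obtain ⟨q, hq, hxq⟩ := hcon x hx h2
      exact Or.inr (Set.mem_biUnion hq hxq)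
  -- Prime avoidance tolerates up to two ideals that are not prime, so `m ^ 2` may join the minimal
  -- primes.
  obtain ⟨I, hI, hle⟩ := (Ideal.subset_union_prime_finite (hfin.insert _) (f := id)
    (maximalIdeal A ^ 2) (maximalIdeal A ^ 2) fun I hI h _ =>
      (Set.mem_of_mem_insert_of_ne hI h : I ∈ minimalPrimes A).1.1).mp hsub
  rcases hI with rfl | hI
  · have hbot : maximalIdeal A = ⊥ := by
      refine Submodule.eq_bot_of_le_smul_of_le_jacobson_bot (maximalIdeal A) _
        (IsNoetherian.noetherian _) ?_ (IsLocalRing.jacobson_eq_maximalIdeal _ bot_ne_top).ge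
      rw [smul_eq_mul, ← pow_two]; exact hle
    refine hm ?_
    rw [hbot]
    have : (⊥ : Ideal A).IsPrime := hbot ▸ inferInstance
    exact ⟨⟨this, le_rfl⟩, fun _ _ _ => bot_le⟩
  · have := hI.1.1
    refine hm ?_
    rwa [← (maximalIdeal.isMaximal A).eq_of_le this.ne_top hle] at hI

/-- Induction through `A / x` with `x` outside `m ^ 2` and all minimal primes. Being a domain is
part of the induction: it passes up from `A / x` because `(x)` is then prime, and it makes `x` a
nonzerodivisor. -/
theorem exists_isRegular_of_spanFinrank_eq (d : ℕ) : ∀ (A : Type*) [CommRing A] [IsLocalRing A]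
    [IsNoetherianRing A] (_ : ringKrullDim A = d) (s : Finset A)
    (_ : Ideal.span (s : Set A) = maximalIdeal A) (_ : s.card ≤ d),
    IsDomain A ∧ ∃ rs : List A, (∀ x ∈ rs, x ∈ maximalIdeal A) ∧ IsRegular A rs ∧
      rs.length = d := by
  induction d with
  | zero =>
    intro A _ _ _ _ s hs hcard
    obtain rfl : s = ∅ := Finset.card_eq_zero.mp (Nat.le_zero.mp hcard)
    have hbot : maximalIdeal A = ⊥ := by rw [← hs]; simp
    have : (⊥ : Ideal A).IsPrime := hbot ▸ inferInstance
    exact ⟨IsDomain.of_bot_isPrime A, [], by simp, IsRegular.nil A A, rfl⟩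
  | succ d ih =>
    classical
    intro A _ _ _ hdim s hs hcard
    obtain ⟨x, hx, hx2, hxq⟩ := exists_mem_maximalIdeal_notMem_sq_notMem_minimalPrimes (A := A) (by
      rw [hdim]; exact_mod_cast Nat.succ_ne_zero d)
    obtain ⟨t, ht, htm, hle⟩ := exists_span_insert_eq_maximalIdeal hs hcard hx hx2
    have hnt : Nontrivial (A ⧸ Ideal.span {x}) := Ideal.Quotient.nontrivial_iff.mpr fun h =>
      (maximalIdeal.isMaximal A).ne_top (top_le_iff.mp (h ▸ (Ideal.span_singleton_le_iff_mem _).mpr hx))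
    let π := Ideal.Quotient.mk (Ideal.span {x})
    have hloc : IsLocalRing (A ⧸ Ideal.span {x}) :=
      IsLocalRing.of_surjective' π Ideal.Quotient.mk_surjective
    have hmax : maximalIdeal (A ⧸ Ideal.span {x}) = (maximalIdeal A).map π :=
      ((IsLocalRing.map_maximalIdeal_of_surjective π Ideal.Quotient.mk_surjective)).symm
    have hgen : Ideal.span ((t.image π : Finset _) : Set (A ⧸ Ideal.span {x})) =
        maximalIdeal (A ⧸ Ideal.span {x}) := by
      rw [hmax, Finset.coe_image, ← Ideal.map_span]
      refine le_antisymm (Ideal.map_mono (Ideal.span_le.mpr htm)) ((Ideal.map_mono hle).trans ?_)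
      rw [Ideal.map_sup, sup_le_iff]
      refine ⟨?_, le_rfl⟩
      rw [Ideal.map_le_iff_le_comap]
      intro y hy
      rw [Ideal.mem_comap, Ideal.Quotient.eq_zero_iff_mem.mpr hy]
      exact zero_mem _
    have hcard' : (t.image π).card ≤ d := Finset.card_image_le.trans ht
    -- At most `d` by the number of generators; at least `d` because one element lowers the
    -- dimension by at most one.
    have hdim' : ringKrullDim (A ⧸ Ideal.span {x}) = d := by
      apply le_antisymm
      · refine (ringKrullDim_le_spanFinrank_maximalIdeal _).trans ?_
        rw [← hgen]
        refine mod_cast (Submodule.spanFinrank_span_le_ncard_of_finite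
          (Finset.finite_toSet _)).trans ?_
        rwa [Set.ncard_coe_finset]
      · have h := ringKrullDim_le_ringKrullDim_quotient_add_card (R := A) {x} (by
          rw [IsLocalRing.ringJacobson_eq_maximalIdeal]; simpa using hx)
        rw [hdim, Finset.coe_singleton, Finset.card_singleton] at h
        exact ENat.WithBot.add_le_add_natCast_right_iff (c := 1) |>.mp (by exact_mod_cast h)
    obtain ⟨hdom, rs, hmem, hreg, hlen⟩ := ih _ hdim' _ hgen hcard'
    have hAdom : IsDomain A := isDomain_of_isPrime_span_singleton hx
      ((Ideal.Quotient.isDomain_iff_prime _).mp hdom) hxq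
    refine ⟨hAdom, ?_⟩
    have hsurj : Function.Surjective π := Ideal.Quotient.mk_surjective
    let rs' := rs.map (Function.surjInv hsurj)
    have hrs' : rs'.map π = rs := by
      simp [rs', List.map_map, Function.comp_def, Function.surjInv_eq hsurj]
    have hx0 : x ≠ 0 := by
      rintro rfl
      exact hx2 (zero_mem _)
    have hmem' : ∀ y ∈ x :: rs', y ∈ maximalIdeal A := by
      intro y hy
      rcases List.mem_cons.mp hy with rfl | hy
      · exact hx
      · have h1 := hmem (π y) (hrs' ▸ List.mem_map_of_mem hy)
        rw [mem_maximalIdeal, mem_nonunits_iff] at h1 ⊢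
        exact fun hu => h1 (hu.map π)
    refine ⟨x :: rs', hmem', .of_isWeaklyRegular_of_mem_maximalIdeal _ hmem'
      (.cons (fun a b hab => mul_left_cancel₀ hx0 hab) ?_), by simp [rs', hlen]⟩
    have hw : IsWeaklyRegular (A ⧸ Ideal.span {x}) rs' := by
      rw [← isWeaklyRegular_map_algebraMap_iff (A ⧸ Ideal.span {x})]
      change IsWeaklyRegular _ (rs'.map π)
      rw [hrs']
      exact hreg.toIsWeaklyRegular
    refine (LinearEquiv.isWeaklyRegular_congr (Submodule.quotEquivOfEq _ _ ?_) rs').mp hw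
    rw [← Submodule.ideal_span_singleton_smul, smul_eq_mul, Ideal.mul_top]

theorem IsRegularLocalRing.isCohenMacaulayRing {A : Type*} [CommRing A] [IsRegularLocalRing A] :
    IsCohenMacaulayRing A := by
  refine ⟨inferInstance, fun m hm => ?_⟩
  obtain rfl := IsLocalRing.eq_maximalIdeal hm
  have hfg := (maximalIdeal A).fg_of_isNoetherianRing
  have hfin := Submodule.FG.finite_generators hfg
  obtain ⟨-, rs, hmem, hreg, hlen⟩ := exists_isRegular_of_spanFinrank_eq
    (maximalIdeal A).spanFinrank A IsRegularLocalRing.spanFinrank_maximalIdeal.symm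
    hfin.toFinset (by rw [Set.Finite.coe_toFinset]; exact (maximalIdeal A).span_generators)
    (by rw [← Set.ncard_eq_toFinset_card _ hfin, Submodule.FG.generators_ncard hfg])
  have h := hreg.toIsWeaklyRegular.isRegular_of_isLocalization_of_mem
    (Localization.AtPrime (maximalIdeal A)) (maximalIdeal A) hmem
  refine .of_isRegular _ ?_ h ?_
  · intro y hy
    obtain ⟨z, hz, rfl⟩ := List.mem_map.mp hy
    exact (IsLocalization.AtPrime.to_map_mem_maximal_iff _ (maximalIdeal A) z).mpr (hmem z hz)
  · rw [IsLocalization.AtPrime.ringKrullDim_eq_height (maximalIdeal A), List.length_map, hlen,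
      maximalIdeal_height_eq_ringKrullDim, IsRegularLocalRing.spanFinrank_maximalIdeal]

end RegularLocal

/-! ### Height one primes of a normal Noetherian domain -/

section HeightOne

variable {S L : Type*} [CommRing S] [IsDomain S] [IsNoetherianRing S] [IsIntegrallyClosed S]
  [Field L] [Algebra S L] [IsFractionRing S L]

/-- An element of the fraction field outside a Noetherian integrally closed domain is outside
its localization at some height one prime, whose maximal ideal moreover is principal. -/
theorem exists_height_eq_one_of_notMem_range {e : L} (he : e ∉ (algebraMap S L).range) :
    ∃ Q : Ideal S, Q.IsPrime ∧ Q.height = 1 ∧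
      (∃ t ∈ Q, t ≠ 0 ∧ ∀ q ∈ Q, ∃ u ∉ Q, t ∣ q * u) ∧
      ∀ s c : S, e * algebraMap S L s = algebraMap S L c → s ∈ Q := by
  obtain ⟨a, b, hb, rfl⟩ := IsFractionRing.div_surjective (A := S) e
  have hb0 : b ≠ 0 := nonZeroDivisors.ne_zero hb
  have hbL : algebraMap S L b ≠ 0 := by simpa using hb0
  have hinj := IsFractionRing.injective S L
  have hx : (Ideal.Quotient.mk (Ideal.span {b}) a) ≠ 0 := by
    rw [Ne, Ideal.Quotient.eq_zero_iff_mem, Ideal.mem_span_singleton]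
    rintro ⟨c, rfl⟩
    exact he ⟨c, by rw [map_mul, mul_div_cancel_left₀ _ hbL]⟩
  -- With `e = a / b`, the prime `Q = (b : y)` is an associated prime of `S / b` containing every
  -- denominator of `e`.
  obtain ⟨Q, hQ, hle⟩ := exists_le_isAssociatedPrime_of_isNoetherianRing S _ hx
  obtain ⟨hQp, y, hy⟩ := (isAssociatedPrime_iff (R := S)).mp hQ
  obtain ⟨y, rfl⟩ := Ideal.Quotient.mk_surjective y
  have hcolon : ∀ z s : S, s ∈ (⊥ : Submodule S (S ⧸ Ideal.span {b})).colon
      {Ideal.Quotient.mk (Ideal.span {b}) z} ↔ b ∣ s * z := by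
    intro z s
    rw [Submodule.mem_colon_singleton, Submodule.mem_bot, Algebra.smul_def,
      Ideal.Quotient.algebraMap_eq, ← map_mul, Ideal.Quotient.eq_zero_iff_mem,
      Ideal.mem_span_singleton]
  have hmem : ∀ s, s ∈ Q ↔ b ∣ s * y := fun s => by rw [hy, hcolon]
  -- Otherwise `y / b` maps the finitely generated module `Q` into itself, hence is integral, hence
  -- lies in `S`, forcing `1 ∈ Q`. The resulting `t` generates `Q S_Q`, so Krull's theorem bounds
  -- the height.
  obtain ⟨t, htQ, u, huQ, htu⟩ : ∃ t ∈ Q, ∃ u ∉ Q, t * y = b * u := by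
    by_contra! hcon
    have hint : IsIntegral S (algebraMap S L y / algebraMap S L b) := by
      refine isIntegral_of_smul_mem_submodule (Submodule.map (Algebra.linearMap S L) Q) ?_
        (Submodule.FG.map _ (IsNoetherian.noetherian Q)) _ ?_
      · rw [Submodule.ne_bot_iff]
        exact ⟨_, ⟨b, (hmem b).mpr (dvd_mul_right _ _), rfl⟩, hbL⟩
      · rintro _ ⟨q, hq, rfl⟩
        obtain ⟨v, hv⟩ := (hmem q).mp hq
        refine ⟨v, by_contra fun hvQ => hcon q hq v hvQ hv, ?_⟩
        have := congrArg (algebraMap S L) hv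
        rw [map_mul, map_mul] at this
        rw [Algebra.linearMap_apply, Algebra.linearMap_apply, smul_eq_mul]
        field_simp
        linear_combination -this
    obtain ⟨c, hc⟩ := IsIntegrallyClosed.algebraMap_eq_of_integral hint
    rw [eq_div_iff hbL, ← map_mul] at hc
    refine hQp.one_notMem ((hmem 1).mpr ⟨c, ?_⟩)
    rw [one_mul, ← hinj hc, mul_comm]
  have hu0 : u ≠ 0 := by
    rintro rfl
    exact huQ (zero_mem _)
  have ht0 : t ≠ 0 := by
    rintro rfl
    rw [zero_mul] at htu
    exact mul_ne_zero hb0 hu0 htu.symm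
  have hdvd : ∀ q ∈ Q, t ∣ q * u := by
    intro q hq
    obtain ⟨v, hv⟩ := (hmem q).mp hq
    refine ⟨v, mul_left_cancel₀ hb0 ?_⟩
    linear_combination t * hv - q * htu
  refine ⟨Q, hQp, le_antisymm ?_ ?_, ⟨t, htQ, ht0, fun q hq => ⟨u, huQ, hdvd q hq⟩⟩, ?_⟩
  · have hmin : Q ∈ (Ideal.span {t}).minimalPrimes := by
      refine ⟨⟨hQp, (Ideal.span_singleton_le_iff_mem _).mpr htQ⟩, fun P hP hPQ q hq => ?_⟩
      have htP : t ∈ P := (Ideal.span_singleton_le_iff_mem _).mp hP.2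
      exact (hP.1.mem_or_mem (P.mem_of_dvd (hdvd q hq) htP)).resolve_right fun h => huQ (hPQ h)
    exact Ideal.height_le_one_of_isPrincipal_of_mem_minimalPrimes _ _ hmin
  · rw [Order.one_le_iff_ne_zero, Ne, Ideal.height_eq_zero_iff_eq_bot]
    rintro rfl
    exact ht0 htQ
  · intro s c hsc
    refine hle ((hcolon a s).mpr ⟨c, hinj ?_⟩)
    rw [map_mul, map_mul, ← hsc]
    field_simp

omit [IsIntegrallyClosed S] in
theorem exists_height_eq_one_mem {f : S} (hf : f ≠ 0) (hu : ¬ IsUnit f) :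
    ∃ Q : Ideal S, Q.IsPrime ∧ Q.height = 1 ∧ f ∈ Q := by
  obtain ⟨Q, hQ⟩ := Ideal.nonempty_minimalPrimes (I := Ideal.span {f})
    (by rwa [Ne, Ideal.span_singleton_eq_top])
  have hfQ : f ∈ Q := (Ideal.span_singleton_le_iff_mem _).mp hQ.1.2
  have := hQ.1.1
  refine ⟨Q, hQ.1.1, le_antisymm
    (Ideal.height_le_one_of_isPrincipal_of_mem_minimalPrimes _ _ hQ) ?_, hfQ⟩
  rw [Order.one_le_iff_ne_zero, Ne, Ideal.height_eq_zero_iff_eq_bot]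
  rintro rfl
  exact hf hfQ

omit [IsNoetherianRing S] [IsIntegrallyClosed S] in
theorem IsSquareFreeElement.prime_algebraMap {f : S} (hf : IsSquareFreeElement f) (hf0 : f ≠ 0)
    (Q : Ideal S) [Q.IsPrime] (hQ : Q.height = 1) (hfQ : f ∈ Q) :
    Prime (algebraMap S (Localization.AtPrime Q) f) ∧
      IsLocalRing.maximalIdeal (Localization.AtPrime Q) =
        Ideal.span {algebraMap S (Localization.AtPrime Q) f} := by
  have h := hf Q hQ hfQ
  rw [Ideal.map_span, Set.image_singleton, Localization.AtPrime.map_eq_maximalIdeal] at h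
  refine ⟨?_, h.symm⟩
  rw [← Ideal.span_singleton_prime, h]
  · infer_instance
  · exact (map_ne_zero_iff _ (IsLocalization.injective _ Q.primeCompl_le_nonZeroDivisors)).mpr hf0

end HeightOne

/-! ### Valuations in a class one tower -/

section ClassOneTower

variable {S : Type*} [CommRing S] [IsDomain S] [IsNoetherianRing S]
  {p : ℕ} {r : ℕ} {f : Fin r → S}

/-- If `p ∣ f i`, then `p ∣ h`, so even `p ^ 2 ∣ f i`. At a height one prime containing `p`, `f i`
is a uniformizer and divides `p`, giving `p ^ 2 ∣ p` there. -/
theorem IsClassOneTower.not_dvd (hp : p.Prime) (hpS : Prime (p : S)) (hf0 : ∀ i, f i ≠ 0)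
    (hsq : ∀ i, IsSquareFreeElement (f i)) (hf : IsClassOneTower p f) (i : Fin r) :
    ¬ (p : S) ∣ f i := by
  intro hdvd
  obtain ⟨h, hh⟩ := hf.isPow_mod_sq i
  obtain ⟨g, hg⟩ := Ideal.mem_span_singleton.mp hh
  have hph : (p : S) ∣ h := by
    refine hpS.dvd_of_dvd_pow (n := p) ?_
    have : h ^ p = f i - (p : S) ^ 2 * g := by rw [← hg]; ring
    rw [this]
    exact dvd_sub hdvd (Dvd.dvd.mul_right (dvd_pow_self _ two_ne_zero) _)
  have hp2 : (p : S) ^ 2 ∣ f i := by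
    have : f i = h ^ p + (p : S) ^ 2 * g := by rw [← hg]; ring
    rw [this]
    exact dvd_add ((pow_dvd_pow_of_dvd hph 2).trans (pow_dvd_pow _ hp.two_le)) (dvd_mul_right _ _)
  obtain ⟨Q, hQp, hQ, hpQ⟩ := exists_height_eq_one_mem hpS.ne_zero hpS.not_isUnit
  obtain ⟨hprime, hmax⟩ := (hsq i).prime_algebraMap (hf0 i) Q hQ (Q.mem_of_dvd hdvd hpQ)
  have h1 : algebraMap S (Localization.AtPrime Q) p ∈
      IsLocalRing.maximalIdeal (Localization.AtPrime Q) :=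
    (IsLocalization.AtPrime.to_map_mem_maximal_iff _ Q _).mpr hpQ
  rw [hmax, Ideal.mem_span_singleton] at h1
  have h2 := (map_dvd (algebraMap S (Localization.AtPrime Q)) hp2).trans h1
  rw [map_pow, pow_two] at h2
  have hp0 : algebraMap S (Localization.AtPrime Q) p ≠ 0 :=
    (map_ne_zero_iff _ (IsLocalization.injective _ Q.primeCompl_le_nonZeroDivisors)).mpr hpS.ne_zero
  have h3 := (mul_dvd_mul_iff_left hp0).mp (h2.trans (mul_one _).symm.dvd)
  have h4 : algebraMap S (Localization.AtPrime Q) p ∉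
      IsLocalRing.maximalIdeal (Localization.AtPrime Q) := by
    rw [IsLocalRing.mem_maximalIdeal, mem_nonunits_iff, not_not]
    exact isUnit_of_dvd_one h3
  exact h4 ((IsLocalization.AtPrime.to_map_mem_maximal_iff _ Q _).mpr hpQ)

omit [IsDomain S] [IsNoetherianRing S] in
/-- At a height one prime containing `f i`, a monomial in the tower is a unit times a power
of `f i`. -/
theorem IsClassOneTower.exists_isUnit_prod_eq (hf : IsClassOneTower p f) (Q : Ideal S) [Q.IsPrime]
    (hQ : Q.height = 1) (i : Fin r) (hi : f i ∈ Q) (j : Fin r → ℕ) :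
    ∃ u : Localization.AtPrime Q, IsUnit u ∧
      algebraMap S (Localization.AtPrime Q) (∏ l, f l ^ j l) =
        u * algebraMap S (Localization.AtPrime Q) (f i) ^ j i := by
  classical
  refine ⟨algebraMap S _ (∏ l ∈ Finset.univ.erase i, f l ^ j l), ?_, ?_⟩
  · rw [IsLocalization.AtPrime.isUnit_to_map_iff _ Q]
    refine Q.primeCompl.prod_mem fun l hl => Q.primeCompl.pow_mem (fun hlQ => ?_) _
    exact hf.no_common_heightOne_prime l i (Finset.ne_of_mem_erase hl) Q ‹_› hQ ⟨hlQ, hi⟩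
  · rw [← Finset.prod_erase_mul _ _ (Finset.mem_univ i), map_mul, map_pow]

/-- At a height one prime containing `f i` the two sides have valuations congruent to `j i` and `k
i` modulo `p`. -/
theorem IsClassOneTower.exponents_eq (hf0 : ∀ i, f i ≠ 0)
    (hfu : ∀ i, ¬ IsUnit (f i))
    (hsq : ∀ i, IsSquareFreeElement (f i)) (hf : IsClassOneTower p f) (j k : Fin r → ℕ)
    (hj : ∀ i, j i < p) (hk : ∀ i, k i < p) {a b : S} (ha : a ≠ 0) (hb : b ≠ 0)
    (h : a ^ p * ∏ i, f i ^ j i = b ^ p * ∏ i, f i ^ k i) : j = k := by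
  funext i
  obtain ⟨Q, hQp, hQ, hiQ⟩ := exists_height_eq_one_mem (hf0 i) (hfu i)
  obtain ⟨hprime, -⟩ := (hsq i).prime_algebraMap (hf0 i) Q hQ hiQ
  obtain ⟨u, hu, hju⟩ := hf.exists_isUnit_prod_eq Q hQ i hiQ j
  obtain ⟨v, hv, hkv⟩ := hf.exists_isUnit_prod_eq Q hQ i hiQ k
  have hinj : Function.Injective (algebraMap S (Localization.AtPrime Q)) :=
    IsLocalization.injective _ Q.primeCompl_le_nonZeroDivisors
  have hA := congrArg (algebraMap S (Localization.AtPrime Q)) h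
  rw [map_mul, map_mul, hju, hkv, map_pow, map_pow] at hA
  set π := algebraMap S (Localization.AtPrime Q) (f i)
  have hfin : ∀ x : Localization.AtPrime Q, x ≠ 0 → FiniteMultiplicity π x := fun x hx =>
    FiniteMultiplicity.of_not_isUnit hprime.not_isUnit hx
  have key : ∀ (c w : Localization.AtPrime Q) (n : ℕ), c ≠ 0 → IsUnit w →
      multiplicity π (c ^ p * (w * π ^ n)) = p * multiplicity π c + n := by
    intro c w n hc hw
    have h0 : c ^ p * (w * π ^ n) ≠ 0 :=
      mul_ne_zero (pow_ne_zero _ hc) (mul_ne_zero hw.ne_zero (pow_ne_zero _ hprime.ne_zero))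
    rw [multiplicity_mul hprime (hfin _ h0), multiplicity_mul hprime (hfin _ (right_ne_zero_of_mul h0)),
      FiniteMultiplicity.multiplicity_pow hprime (hfin _ hc), multiplicity_pow_self_of_prime hprime,
      multiplicity_eq_zero.mpr (fun hd => hprime.not_isUnit (isUnit_of_dvd_unit hd hw)), zero_add]
  have ha' := (map_ne_zero_iff _ hinj).mpr ha
  have hb' := (map_ne_zero_iff _ hinj).mpr hb
  have hm := congrArg (multiplicity π) hA
  rw [key _ _ _ ha' hu, key _ _ _ hb' hv] at hm
  have := congrArg (· % p) hm
  simpa [Nat.mul_add_mod, Nat.mod_eq_of_lt (hj i), Nat.mod_eq_of_lt (hk i)] using this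

/-- A pole of `e` at a height one prime contributes at least `p` to the pole order of `e ^ p`, while
the product of the `f i` has valuation less than `p` there. -/
theorem IsClassOneTower.mem_range_of_pow_mul_prod_mem_range {L : Type*} [Field L] [Algebra S L]
    [IsFractionRing S L] [IsIntegrallyClosed S] (hp : p.Prime) (hf0 : ∀ i, f i ≠ 0)
    (hsq : ∀ i, IsSquareFreeElement (f i)) (hf : IsClassOneTower p f) (j : Fin r → ℕ)
    (hj : ∀ i, j i < p) {e : L}
    (he : e ^ p * algebraMap S L (∏ i, f i ^ j i) ∈ (algebraMap S L).range) :
    e ∈ (algebraMap S L).range := by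
  by_contra hcon
  obtain ⟨Q, hQp, hQ, ⟨t, htQ, ht0, htdvd⟩, hden⟩ := exists_height_eq_one_of_notMem_range hcon
  obtain ⟨c, hc⟩ := he
  obtain ⟨a, b, hb, rfl⟩ := IsFractionRing.div_surjective (A := S) e
  have hb0 : b ≠ 0 := nonZeroDivisors.ne_zero hb
  have hbL : algebraMap S L b ≠ 0 := by simpa using hb0
  have ha0 : a ≠ 0 := by
    rintro rfl
    exact hcon ⟨0, by simp⟩
  have hSL := IsFractionRing.injective S L
  have hinj : Function.Injective (algebraMap S (Localization.AtPrime Q)) :=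
    IsLocalization.injective _ Q.primeCompl_le_nonZeroDivisors
  have hcS : c * b ^ p = a ^ p * ∏ i, f i ^ j i := by
    apply hSL
    rw [map_mul, map_mul, hc, map_pow, map_pow, div_pow]
    field_simp
  have hmax : IsLocalRing.maximalIdeal (Localization.AtPrime Q) =
      Ideal.span {algebraMap S (Localization.AtPrime Q) t} := by
    rw [← Localization.AtPrime.map_eq_maximalIdeal]
    refine le_antisymm (Ideal.map_le_iff_le_comap.mpr fun q hq => ?_)
      ((Ideal.span_singleton_le_iff_mem _).mpr (Ideal.mem_map_of_mem _ htQ))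
    obtain ⟨u, hu, hdvd⟩ := htdvd q hq
    have hu' : IsUnit (algebraMap S (Localization.AtPrime Q) u) :=
      (IsLocalization.AtPrime.isUnit_to_map_iff _ Q u).mpr hu
    rw [Ideal.mem_comap, Ideal.mem_span_singleton, ← hu'.dvd_mul_right, ← map_mul]
    exact map_dvd _ hdvd
  have hfield : ¬ IsField (Localization.AtPrime Q) := by
    rw [IsLocalRing.isField_iff_maximalIdeal_eq, hmax, Ideal.span_singleton_eq_bot,
      map_eq_zero_iff _ hinj]
    exact ht0
  have hdvr : IsDiscreteValuationRing (Localization.AtPrime Q) :=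
    ((IsDiscreteValuationRing.TFAE _ hfield).out 0 4).mpr (by rw [hmax]; exact ⟨_, rfl⟩)
  have hndvd : ¬ algebraMap S (Localization.AtPrime Q) b ∣ algebraMap S (Localization.AtPrime Q) a := by
    rintro ⟨m, hm⟩
    obtain ⟨x, s, rfl⟩ := IsLocalization.exists_mk'_eq Q.primeCompl m
    refine s.2 (hden s x ?_)
    have h1 : a * s = b * x := by
      apply hinj
      rw [map_mul, map_mul, hm, mul_assoc, IsLocalization.mk'_spec]
    have := congrArg (algebraMap S L) h1
    rw [map_mul, map_mul] at this
    field_simp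
    linear_combination this
  -- In the discrete valuation ring `S_Q`, `m` is the inverse of `e`, a non-unit.
  obtain ⟨m, hm⟩ := (ValuationRing.dvd_total _ _).resolve_left hndvd
  have hmu : ¬ IsUnit m := fun hu => hndvd (hm ▸ hu.mul_right_dvd.mpr dvd_rfl)
  have hF : algebraMap S (Localization.AtPrime Q) c * m ^ p =
      algebraMap S (Localization.AtPrime Q) (∏ i, f i ^ j i) := by
    have h1 := congrArg (algebraMap S (Localization.AtPrime Q)) hcS
    rw [map_mul, map_mul, map_pow, map_pow, hm, mul_pow] at h1
    have ha' : algebraMap S (Localization.AtPrime Q) a ^ p ≠ 0 :=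
      pow_ne_zero _ ((map_ne_zero_iff _ hinj).mpr ha0)
    apply mul_left_cancel₀ ha'
    linear_combination h1
  by_cases hex : ∃ i, f i ∈ Q
  · obtain ⟨i, hi⟩ := hex
    obtain ⟨hprime, hmax'⟩ := (hsq i).prime_algebraMap (hf0 i) Q hQ hi
    obtain ⟨u, hu, hju⟩ := hf.exists_isUnit_prod_eq Q hQ i hi j
    have hdm : algebraMap S (Localization.AtPrime Q) (f i) ∣ m := by
      rw [← Ideal.mem_span_singleton, ← hmax']
      exact hmu
    have h1 : algebraMap S (Localization.AtPrime Q) (f i) ^ p ∣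
        u * algebraMap S (Localization.AtPrime Q) (f i) ^ j i := by
      rw [← hju, ← hF]
      exact (pow_dvd_pow_of_dvd hdm p).mul_left _
    rw [hu.dvd_mul_left, pow_dvd_pow_iff hprime.ne_zero hprime.not_isUnit] at h1
    exact absurd (hj i) (not_lt.mpr h1)
  · push Not at hex
    refine hmu ((isUnit_pow_iff hp.ne_zero).mp (isUnit_of_dvd_unit (Dvd.intro_left _ hF) ?_))
    exact (IsLocalization.AtPrime.isUnit_to_map_iff _ Q _).mpr
      (Q.primeCompl.prod_mem fun l _ => Q.primeCompl.pow_mem (hex l) _)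

end ClassOneTower

/-! ### Traces of radicals and the monomial basis -/

open Polynomial in
/-- A `p`-th root of an element that is not a `p`-th power has trace zero. -/
theorem Algebra.trace_eq_zero_of_pow_eq {L K : Type*} [Field L] [Field K] [Algebra L K]
    [FiniteDimensional L K] {p : ℕ} (hp : p.Prime) {z : K} {g : L} (hz : z ^ p = algebraMap L K g)
    (hg : ∀ b : L, b ^ p ≠ g) : Algebra.trace L K z = 0 := by
  have hirr := X_pow_sub_C_irreducible_of_prime hp hg
  have hmin : minpoly L z = X ^ p - C g :=
    (minpoly.eq_of_irreducible_of_monic hirr (by simp [hz]) (monic_X_pow_sub_C g hp.ne_zero)).symm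
  have hnext : (minpoly L z).nextCoeff = 0 := by
    rw [hmin, nextCoeff_of_natDegree_pos (by rw [natDegree_X_pow_sub_C]; exact hp.pos),
      natDegree_X_pow_sub_C, coeff_sub, coeff_X_pow, coeff_C,
      if_neg (by have := hp.pos; omega), if_neg (by have := hp.two_le; omega), sub_zero]
  rw [trace_eq_finrank_mul_minpoly_nextCoeff, hnext, neg_zero, mul_zero]

section Monomials

variable {S L K : Type*} [CommRing S] [IsDomain S] [IsNoetherianRing S]
  [Field L] [Algebra S L] [IsFractionRing S L] [Field K] [Algebra L K] [Algebra S K]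
  [IsScalarTower S L K] {p r : ℕ} {f : Fin r → S} {ω : Fin r → K}

omit [IsDomain S] [IsNoetherianRing S] [IsFractionRing S L] in
theorem span_range_prod_pow_eq_top [FiniteDimensional L K] (hp : p.Prime)
    (hω : ∀ i, ω i ^ p = algebraMap S K (f i))
    (htop : IntermediateField.adjoin L (Set.range ω) = ⊤) :
    Submodule.span L (Set.range fun j : Fin r → Fin p => ∏ i, ω i ^ (j i : ℕ)) = ⊤ := by
  have hmem : ∀ j : Fin r → ℕ, ∏ i, ω i ^ j i ∈
      Submodule.span L (Set.range fun j : Fin r → Fin p => ∏ i, ω i ^ (j i : ℕ)) := by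
    intro j
    have h1 : ∏ i, ω i ^ j i = (algebraMap S L (∏ i, f i ^ (j i / p))) •
        ∏ i, ω i ^ (j i % p) := by
      rw [Algebra.smul_def, ← IsScalarTower.algebraMap_apply, map_prod, ← Finset.prod_mul_distrib]
      refine Finset.prod_congr rfl fun i _ => ?_
      rw [map_pow, ← hω, ← pow_mul, ← pow_add, Nat.div_add_mod]
    rw [h1]
    exact Submodule.smul_mem _ _
      (Submodule.subset_span ⟨fun i => ⟨j i % p, Nat.mod_lt _ hp.pos⟩, rfl⟩)
  have hclosure : ∀ x ∈ Submonoid.closure (Set.range ω), ∃ j : Fin r → ℕ, x = ∏ i, ω i ^ j i := by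
    intro x hx
    induction hx using Submonoid.closure_induction with
    | mem x hx =>
      obtain ⟨i, rfl⟩ := hx
      exact ⟨Pi.single i 1, by simp [Pi.single_apply, pow_ite]⟩
    | one => exact ⟨0, by simp⟩
    | mul x y _ _ hx hy =>
      obtain ⟨j, rfl⟩ := hx
      obtain ⟨k, rfl⟩ := hy
      exact ⟨j + k, by simp [pow_add, Finset.prod_mul_distrib]⟩
  have hadj : Algebra.adjoin L (Set.range ω) = ⊤ := by
    rw [← IntermediateField.adjoin_toSubalgebra_of_isAlgebraic, htop,
      IntermediateField.top_toSubalgebra]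
    exact fun x _ => Algebra.IsAlgebraic.isAlgebraic x
  rw [eq_top_iff, ← Algebra.top_toSubmodule, ← hadj, Algebra.adjoin_eq_span, Submodule.span_le]
  intro x hx
  obtain ⟨j, rfl⟩ := hclosure x hx
  exact hmem j

/-- For `j ≠ k` the quotient is a `p`-th root of an element of `L` that `exponents_eq` prevents from
being a `p`-th power. This orthogonality yields both linear independence and the coefficient
formula. -/
theorem trace_prod_pow_mul_inv [FiniteDimensional L K] (hp : p.Prime) (hf0 : ∀ i, f i ≠ 0)
    (hfu : ∀ i, ¬ IsUnit (f i)) (hsq : ∀ i, IsSquareFreeElement (f i)) (hf : IsClassOneTower p f)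
    (hω : ∀ i, ω i ^ p = algebraMap S K (f i)) (j k : Fin r → Fin p) :
    Algebra.trace L K ((∏ i, ω i ^ (j i : ℕ)) * (∏ i, ω i ^ (k i : ℕ))⁻¹) =
      if j = k then (Module.finrank L K : L) else 0 := by
  have hSL := IsFractionRing.injective S L
  have hf0' : ∀ i, algebraMap S L (f i) ≠ 0 := fun i => (map_ne_zero_iff _ hSL).mpr (hf0 i)
  have hω0 : ∀ i, ω i ≠ 0 := by
    intro i h0
    have := hω i
    rw [h0, zero_pow hp.ne_zero, IsScalarTower.algebraMap_apply S L K] at this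
    exact hf0' i ((map_eq_zero _).mp this.symm)
  split_ifs with hjk
  · subst hjk
    rw [mul_inv_cancel₀ (Finset.prod_ne_zero_iff.mpr fun i _ => pow_ne_zero _ (hω0 i)),
      ← map_one (algebraMap L K), Algebra.trace_algebraMap, nsmul_eq_mul, mul_one]
  · have hpow : ∀ l : Fin r → Fin p, (∏ i, ω i ^ (l i : ℕ)) ^ p =
        algebraMap L K (algebraMap S L (∏ i, f i ^ (l i : ℕ))) := by
      intro l
      rw [← IsScalarTower.algebraMap_apply, map_prod, ← Finset.prod_pow]
      refine Finset.prod_congr rfl fun i _ => ?_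
      rw [map_pow, ← hω, ← pow_mul, ← pow_mul, mul_comm]
    refine Algebra.trace_eq_zero_of_pow_eq hp (g := algebraMap S L (∏ i, f i ^ (j i : ℕ)) *
      (algebraMap S L (∏ i, f i ^ (k i : ℕ)))⁻¹) ?_ ?_
    · rw [mul_pow, inv_pow, hpow, hpow, map_mul, map_inv₀]
    · intro b hb
      obtain ⟨c, d, hd, rfl⟩ := IsFractionRing.div_surjective (A := S) b
      have hd0 : d ≠ 0 := nonZeroDivisors.ne_zero hd
      have hprod : ∀ l : Fin r → Fin p, algebraMap S L (∏ i, f i ^ (l i : ℕ)) ≠ 0 := fun l =>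
        (map_ne_zero_iff _ hSL).mpr (Finset.prod_ne_zero_iff.mpr fun i _ => pow_ne_zero _ (hf0 i))
      have hdL : algebraMap S L d ≠ 0 := (map_ne_zero_iff _ hSL).mpr hd0
      have hc0 : c ≠ 0 := by
        rintro rfl
        rw [map_zero, zero_div, zero_pow hp.ne_zero] at hb
        exact mul_ne_zero (hprod j) (inv_ne_zero (hprod k)) hb.symm
      have heq : d ^ p * ∏ i, f i ^ (j i : ℕ) = c ^ p * ∏ i, f i ^ (k i : ℕ) := by
        apply hSL
        rw [map_mul, map_mul, map_pow, map_pow]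
        have := hprod k
        rw [div_pow] at hb
        field_simp at hb
        linear_combination -hb
      have := hf.exponents_eq hf0 hfu hsq _ _ (fun i => (j i).2) (fun i => (k i).2) hd0 hc0 heq
      exact hjk (funext fun i => Fin.ext (congrFun this i))

theorem linearIndependent_prod_pow [CharZero L] [FiniteDimensional L K] (hp : p.Prime)
    (hf0 : ∀ i, f i ≠ 0)
    (hfu : ∀ i, ¬ IsUnit (f i)) (hsq : ∀ i, IsSquareFreeElement (f i)) (hf : IsClassOneTower p f)
    (hω : ∀ i, ω i ^ p = algebraMap S K (f i)) :
    LinearIndependent L fun j : Fin r → Fin p => ∏ i, ω i ^ (j i : ℕ) := by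
  classical
  rw [Fintype.linearIndependent_iff]
  intro c hc k
  have h := congrArg (fun y => Algebra.trace L K (y * (∏ i, ω i ^ (k i : ℕ))⁻¹)) hc
  simp only [Finset.sum_mul, smul_mul_assoc, map_sum, map_smul, zero_mul, map_zero,
    trace_prod_pow_mul_inv (L := L) hp hf0 hfu hsq hf hω, smul_eq_mul, mul_ite, mul_zero,
    Finset.sum_ite_eq', Finset.mem_univ, if_true] at h
  exact (mul_eq_zero.mp h).resolve_right (Nat.cast_ne_zero.mpr Module.finrank_pos.ne')

theorem finrank_eq_pow [CharZero L] [FiniteDimensional L K] (hp : p.Prime) (hf0 : ∀ i, f i ≠ 0)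
    (hfu : ∀ i, ¬ IsUnit (f i)) (hsq : ∀ i, IsSquareFreeElement (f i)) (hf : IsClassOneTower p f)
    (hω : ∀ i, ω i ^ p = algebraMap S K (f i))
    (htop : IntermediateField.adjoin L (Set.range ω) = ⊤) : Module.finrank L K = p ^ r := by
  have b := Module.Basis.mk (linearIndependent_prod_pow (L := L) hp hf0 hfu hsq hf hω)
    (span_range_prod_pow_eq_top (L := L) hp hω htop).ge
  rw [Module.finrank_eq_card_basis b]
  simp

theorem finrank_smul_eq_sum_trace [CharZero L] [FiniteDimensional L K] (hp : p.Prime)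
    (hf0 : ∀ i, f i ≠ 0)
    (hfu : ∀ i, ¬ IsUnit (f i)) (hsq : ∀ i, IsSquareFreeElement (f i)) (hf : IsClassOneTower p f)
    (hω : ∀ i, ω i ^ p = algebraMap S K (f i))
    (htop : IntermediateField.adjoin L (Set.range ω) = ⊤) (x : K) :
    (Module.finrank L K : L) • x = ∑ j : Fin r → Fin p,
      Algebra.trace L K (x * (∏ i, ω i ^ (j i : ℕ))⁻¹) • ∏ i, ω i ^ (j i : ℕ) := by
  classical
  have hx : x ∈ Submodule.span L (Set.range fun j : Fin r → Fin p => ∏ i, ω i ^ (j i : ℕ)) := by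
    rw [span_range_prod_pow_eq_top (L := L) hp hω htop]; trivial
  obtain ⟨c, rfl⟩ := (Submodule.mem_span_range_iff_exists_fun L).mp hx
  rw [Finset.smul_sum]
  refine Finset.sum_congr rfl fun k _ => ?_
  simp only [Finset.sum_mul, smul_mul_assoc, map_sum, map_smul,
    trace_prod_pow_mul_inv (L := L) hp hf0 hfu hsq hf hω, smul_eq_mul, mul_ite, mul_zero,
    Finset.sum_ite_eq', Finset.mem_univ, if_true, smul_smul]
  rw [mul_comm]

end Monomials

/-! ### Integrality of traces through conjugates -/

section Integrality

variable {S L Ω : Type*} [CommRing S] [Field L] [Algebra S L] [Field Ω] [Algebra L Ω]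
  [Algebra S Ω]

/-- The trace is the sum of the conjugates; `θ` is one fixed multiplier clearing the denominators of
all conjugates of `β`. -/
theorem isIntegral_algebraMap_trace_mul {K : Type*} [Field K] [Algebra L K] [Algebra S K]
    [IsScalarTower S L K] [IsScalarTower S L Ω] [CharZero L] [FiniteDimensional L K] [IsAlgClosed Ω]
    {x β : K} {θ : Ω} (hx : IsIntegral S x) (h : ∀ σ : K →ₐ[L] Ω, IsIntegral S (σ β * θ)) :
    IsIntegral S (algebraMap L Ω (Algebra.trace L K (x * β)) * θ) := by
  rw [trace_eq_sum_embeddings Ω, Finset.sum_mul]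
  refine IsIntegral.sum _ fun σ _ => ?_
  rw [map_mul, mul_assoc]
  exact (hx.map (σ.restrictScalars S)).mul (h σ)

theorem pow_mul_mem_range_of_isIntegral [IsDomain S] [IsIntegrallyClosed S] [IsFractionRing S L]
    [IsScalarTower S L Ω]
    {y : L} {θ : Ω} {n : ℕ} {g : S} (hθ : θ ^ n = algebraMap S Ω g)
    (h : IsIntegral S (algebraMap L Ω y * θ)) :
    y ^ n * algebraMap S L g ∈ (algebraMap S L).range := by
  have h1 := h.pow n
  rw [mul_pow, hθ, ← map_pow, IsScalarTower.algebraMap_apply S L Ω, ← map_mul,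
    isIntegral_algebraMap_iff (algebraMap L Ω).injective] at h1
  exact IsIntegrallyClosed.algebraMap_eq_of_integral h1

end Integrality

theorem isIntegral_div_of_pow_eq {S Ω : Type*} [CommRing S] [Field Ω] [Algebra S Ω]
    {a b : Ω} {n : ℕ} (hn : 0 < n) (h : a ^ n = b ^ n) :
    IsIntegral S (a / b) := by
  by_cases hb : b = 0
  · subst hb
    rw [div_zero]
    exact isIntegral_zero
  · refine IsIntegral.of_pow hn ?_
    rw [div_pow, h, div_self (pow_ne_zero _ hb)]
    exact isIntegral_one

theorem trace_mul_inv_mem_range {S L K : Type*} [CommRing S] [IsDomain S] [IsNoetherianRing S]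
    [IsIntegrallyClosed S]
    [Field L] [Algebra S L] [IsFractionRing S L] [Field K] [Algebra L K] [Algebra S K]
    [IsScalarTower S L K] {p r : ℕ} {f : Fin r → S} {ω : Fin r → K}
    [CharZero L] [FiniteDimensional L K] (hp : p.Prime) (hf0 : ∀ i, f i ≠ 0)
    (hsq : ∀ i, IsSquareFreeElement (f i)) (hf : IsClassOneTower p f)
    (hω : ∀ i, ω i ^ p = algebraMap S K (f i)) {x : K} (hx : IsIntegral S x)
    (j : Fin r → Fin p) :
    Algebra.trace L K (x * (∏ i, ω i ^ (j i : ℕ))⁻¹) ∈ (algebraMap S L).range := by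
  let Ω := AlgebraicClosure K
  have hpow : (∏ i, ω i ^ (j i : ℕ)) ^ p = algebraMap L K (algebraMap S L (∏ i, f i ^ (j i : ℕ))) := by
    rw [← IsScalarTower.algebraMap_apply, map_prod, ← Finset.prod_pow]
    refine Finset.prod_congr rfl fun i _ => ?_
    rw [map_pow, ← hω, ← pow_mul, ← pow_mul, mul_comm]
  refine hf.mem_range_of_pow_mul_prod_mem_range hp hf0 hsq (fun i => (j i : ℕ))
    (fun i => (j i).2) ?_
  refine pow_mul_mem_range_of_isIntegral (Ω := Ω)
    (θ := algebraMap K Ω (∏ i, ω i ^ (j i : ℕ))) ?_ ?_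
  · rw [← map_pow, hpow, ← IsScalarTower.algebraMap_apply, ← IsScalarTower.algebraMap_apply]
  · refine isIntegral_algebraMap_trace_mul hx fun σ => ?_
    rw [map_inv₀, ← div_eq_inv_mul]
    refine isIntegral_div_of_pow_eq hp.pos ?_
    rw [← map_pow, ← map_pow, hpow, AlgHom.commutes, ← IsScalarTower.algebraMap_apply]

/-! ### One radical: estimates with a `(p-1)`-st root `l` of `p` -/

section LocalIntegrality

variable {S Ω : Type*} [CommRing S] [Field Ω] [Algebra S Ω]

open Polynomial in
theorem isIntegral_of_pow_eq_sum {τ : Ω} {n : ℕ} (c : ℕ → Ω) (hc : ∀ m < n, IsIntegral S (c m))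
    (h : τ ^ n = ∑ m ∈ Finset.range n, c m * τ ^ m) : IsIntegral S τ := by
  let c' : Fin n → integralClosure S Ω := fun m => ⟨c m, hc m m.2⟩
  have hτ : IsIntegral (integralClosure S Ω) τ := by
    refine ⟨X ^ n - ∑ m : Fin n, C (c' m) * X ^ (m : ℕ), monic_X_pow_sub ?_, ?_⟩
    · exact degree_sum_fin_lt c'
    · rw [eval₂_sub, eval₂_pow, eval₂_X, h, eval₂_finsetSum, Finset.sum_range, sub_eq_zero]
      refine Finset.sum_congr rfl fun m _ => ?_
      rw [eval₂_mul, eval₂_C, eval₂_pow, eval₂_X]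
      rfl
  exact isIntegral_trans τ hτ

variable {p : ℕ} {f h g : S} {w l : Ω}

theorem isIntegral_of_pow_eq_natCast (hp : p.Prime) (hl : l ^ (p - 1) = (p : Ω)) :
    IsIntegral S l := by
  refine IsIntegral.of_pow (n := p - 1) (by have := hp.two_le; omega) ?_
  rw [hl, ← map_natCast (algebraMap S Ω)]
  exact isIntegral_algebraMap

/-- Substituting `w = l τ + h` in `w ^ p = f`, every coefficient is divisible by the leading one, `l
^ p = l p`: the middle ones through the binomials, the constant one through `p ^ 2`. -/
theorem isIntegral_sub_div (hp : p.Prime) (hp0 : (p : Ω) ≠ 0) (hl : l ^ (p - 1) = (p : Ω))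
    (hw : w ^ p = algebraMap S Ω f) (hfh : f - h ^ p = (p : S) ^ 2 * g) :
    IsIntegral S ((w - algebraMap S Ω h) / l) := by
  have hp2 := hp.two_le
  have hl0 : l ≠ 0 := by
    rintro rfl
    rw [zero_pow (by omega)] at hl
    exact hp0 hl.symm
  have hlint : IsIntegral S l := isIntegral_of_pow_eq_natCast hp hl
  set τ := (w - algebraMap S Ω h) / l with hτ
  have hwτ : w = l * τ + algebraMap S Ω h := by rw [hτ]; field_simp; ring
  have hlp : l ^ p = l * p := by rw [← hl, ← pow_succ', Nat.sub_add_cancel hp.one_le]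
  have hlp2 : l * l ^ (p - 2) = p := by rw [← hl, ← pow_succ']; congr 1; omega
  -- Coefficients after division by `l p`; the constant one is `p ^ 2 g / (l p) = g l ^ (p - 2)`.
  let c : ℕ → Ω := fun m => if m = 0 then algebraMap S Ω g * l ^ (p - 2) else
    -(l ^ (m - 1) * (algebraMap S Ω h) ^ (p - m) * ((p.choose m / p : ℕ) : Ω))
  refine isIntegral_of_pow_eq_sum c (n := p) ?_ ?_
  · intro m _
    simp only [c]
    split_ifs
    · exact isIntegral_algebraMap.mul (hlint.pow _)
    · refine ((((hlint.pow _).mul (isIntegral_algebraMap.pow _)).mul ?_)).neg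
      rw [← map_natCast (algebraMap S Ω)]
      exact isIntegral_algebraMap
  · have hexp := hw
    have hfS := congrArg (algebraMap S Ω) hfh
    rw [map_sub, map_mul, map_pow, map_pow, map_natCast] at hfS
    rw [hwτ, add_pow, Finset.sum_range_succ] at hexp
    obtain ⟨q, rfl⟩ : ∃ q, p = q + 1 := ⟨p - 1, by omega⟩
    rw [Finset.sum_range_succ'] at hexp ⊢
    have hterm : ∀ m ∈ Finset.range q, (l * τ) ^ (m + 1) * (algebraMap S Ω h) ^ (q + 1 - (m + 1)) *
        ((q + 1).choose (m + 1) : Ω) =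
        -(l * ((q + 1 : ℕ) : Ω)) * (c (m + 1) * τ ^ (m + 1)) := by
      intro m hm
      have hdvd : (q + 1) ∣ (q + 1).choose (m + 1) :=
        hp.dvd_choose_self (Nat.succ_ne_zero m) (by have := Finset.mem_range.mp hm; omega)
      have hch : ((q + 1).choose (m + 1) : Ω) =
          ((q + 1 : ℕ) : Ω) * (((q + 1).choose (m + 1) / (q + 1) : ℕ) : Ω) := by
        rw [← Nat.cast_mul, Nat.mul_div_cancel' hdvd]
      simp only [c, if_neg (Nat.succ_ne_zero m), Nat.add_sub_cancel]
      rw [hch, mul_pow, pow_succ l m]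
      ring
    rw [Finset.sum_congr rfl hterm, ← Finset.mul_sum] at hexp
    simp only [pow_zero, Nat.sub_zero, Nat.choose_zero_right, Nat.cast_one, mul_one, one_mul,
      Nat.sub_self, Nat.choose_self] at hexp
    have hc0 : c 0 = algebraMap S Ω g * l ^ (q + 1 - 2) := by simp [c]
    rw [hc0, pow_zero, mul_one]
    apply mul_left_cancel₀ (mul_ne_zero hl0 hp0)
    rw [mul_pow, hlp] at hexp
    linear_combination hexp + hfS - (q + 1 : ℕ) * algebraMap S Ω g * hlp2

open Polynomial in
-- Euler's dual basis: the sums are the coefficients of `((X + h)^p - w^p) / (X - (w - h))`.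
-- Synthetic division gives a recursion descending from the leading coefficient `1`, each step
-- costing one factor `(w - h) / l`.
theorem isIntegral_pow_mul_sum_choose_div (hp : p.Prime) (hp0 : (p : Ω) ≠ 0)
    (hl : l ^ (p - 1) = (p : Ω))
    (hw : w ^ p = algebraMap S Ω f) (hfh : f - h ^ p = (p : S) ^ 2 * g) {k : ℕ} (hk : k < p) :
    IsIntegral S (l ^ k * (∑ j ∈ Finset.range p,
      (algebraMap S Ω h ^ (j - k) * (j.choose k : Ω)) * w ^ (p - 1 - j)) / p) := by
  have hp2 := hp.two_le
  have hl0 : l ≠ 0 := by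
    rintro rfl
    rw [zero_pow (by omega)] at hl
    exact hp0 hl.symm
  have hlint : IsIntegral S l := isIntegral_of_pow_eq_natCast hp hl
  have hτ := isIntegral_sub_div hp hp0 hl hw hfh
  set η := algebraMap S Ω h with hη
  set a : ℕ → Ω := fun k => ∑ j ∈ Finset.range p, (η ^ (j - k) * (j.choose k : Ω)) * w ^ (p - 1 - j)
    with ha
  let B : Polynomial Ω := ∑ j ∈ Finset.range p, (X + C η) ^ j * (C w) ^ (p - 1 - j)
  have hB : ∀ k, B.coeff k = a k := by
    intro k
    simp only [B, ha, finsetSum_coeff]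
    refine Finset.sum_congr rfl fun j _ => ?_
    rw [← C_pow, coeff_mul_C, coeff_X_add_C_pow]
  have hgeom : B * (X - C (w - η)) = (X + C η) ^ p - C (w ^ p) := by
    have := (Commute.all (X + C η) (C w)).geom_sum₂_mul p
    rw [C_pow, ← this, C_sub]
    ring
  have hrec : ∀ k, a k = (w - η) * a (k + 1) + η ^ (p - (k + 1)) * (p.choose (k + 1) : Ω) := by
    intro k
    have := congrArg (fun P => P.coeff (k + 1)) hgeom
    simp only [coeff_mul_X_sub_C, hB, coeff_sub, coeff_X_add_C_pow, coeff_C,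
      if_neg (Nat.succ_ne_zero k), sub_zero] at this
    linear_combination this
  suffices hd : ∀ d < p, IsIntegral S (l ^ (p - 1 - d) * a (p - 1 - d) / p) by
    have := hd (p - 1 - k) (by omega)
    rwa [show p - 1 - (p - 1 - k) = k by omega] at this
  intro d
  induction d with
  | zero =>
    intro _
    have htop : a (p - 1) = 1 := by
      simp only [ha]
      rw [Finset.sum_eq_single (p - 1)]
      · simp
      · intro j hj hjp
        rw [Nat.choose_eq_zero_of_lt (by have := Finset.mem_range.mp hj; omega)]
        simp
      · intro hcon
        exact absurd (Finset.mem_range.mpr (by omega)) hcon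
    rw [Nat.sub_zero, htop, hl, mul_one, div_self hp0]
    exact isIntegral_one
  | succ d ih =>
    intro hd
    have ih := ih (by omega)
    obtain ⟨k, hk⟩ : ∃ k, p - 1 - d = k + 1 := ⟨p - 1 - d - 1, by omega⟩
    rw [show p - 1 - (d + 1) = k by omega]
    rw [hk] at ih
    have hdvd : p ∣ p.choose (k + 1) := hp.dvd_choose_self (Nat.succ_ne_zero k) (by omega)
    have hch : (p.choose (k + 1) : Ω) = (p : Ω) * ((p.choose (k + 1) / p : ℕ) : Ω) := by
      rw [← Nat.cast_mul, Nat.mul_div_cancel' hdvd]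
    have heq : l ^ k * a k / p = (w - η) / l * (l ^ (k + 1) * a (k + 1) / p) +
        l ^ k * η ^ (p - (k + 1)) * ((p.choose (k + 1) / p : ℕ) : Ω) := by
      rw [hrec, hch]
      field_simp
      ring
    rw [heq]
    refine (hτ.mul ih).add (((hlint.pow _).mul (isIntegral_algebraMap.pow _)).mul ?_)
    rw [← map_natCast (algebraMap S Ω)]
    exact isIntegral_algebraMap

/-- The one-variable estimate for the dual basis of the powers of `w - h`. -/
theorem isIntegral_sum_choose_mul_inv (hp : p.Prime) (hp0 : (p : Ω) ≠ 0)
    (hl : l ^ (p - 1) = (p : Ω)) (hf : algebraMap S Ω f ≠ 0)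
    (hw : w ^ p = algebraMap S Ω f) (hfh : f - h ^ p = (p : S) ^ 2 * g) {θ : Ω}
    (hθ : θ ^ p = algebraMap S Ω f) (k : Fin p) :
    IsIntegral S ((∑ j : Fin p, (algebraMap S Ω h ^ ((j : ℕ) - k) * ((j : ℕ).choose k : Ω)) *
      (w ^ (j : ℕ))⁻¹) * (l ^ (k : ℕ) * θ ^ (p - 1) / p)) := by
  have hw0 : w ≠ 0 := by
    rintro rfl
    exact hf (by rw [← hw, zero_pow hp.ne_zero])
  have h1 := isIntegral_pow_mul_sum_choose_div hp hp0 hl hw hfh k.2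
  -- This replaces `w ^ (p - 1)` by the power of a fixed root `θ`, so that the multiplier does not
  -- depend on the conjugate `w`.
  have h2 : IsIntegral S (θ / w) := isIntegral_div_of_pow_eq hp.pos (hθ.trans hw.symm)
  have h3 := h1.mul (h2.pow (p - 1))
  rw [Finset.sum_range] at h3
  have hsum : ∑ j : Fin p, (algebraMap S Ω h ^ ((j : ℕ) - k) * ((j : ℕ).choose k : Ω)) *
      w ^ (p - 1 - (j : ℕ)) = (∑ j : Fin p, (algebraMap S Ω h ^ ((j : ℕ) - k) *
        ((j : ℕ).choose k : Ω)) * (w ^ (j : ℕ))⁻¹) * w ^ (p - 1) := by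
    rw [Finset.sum_mul]
    refine Finset.sum_congr rfl fun j _ => ?_
    rw [mul_assoc _ _ (w ^ (p - 1)), inv_mul_eq_div, pow_sub₀ w hw0 (by have := j.2; omega),
      div_eq_mul_inv]
  rw [hsum, div_pow] at h3
  have hw1 : w ^ (p - 1) ≠ 0 := pow_ne_zero _ hw0
  refine (congrArg (IsIntegral S) ?_).mp h3
  generalize (∑ j : Fin p, (algebraMap S Ω h ^ ((j : ℕ) - k) * ((j : ℕ).choose k : Ω)) *
      (w ^ (j : ℕ))⁻¹) = A
  field_simp

end LocalIntegrality

/-- If `p` is prime and `c` is not divisible by `p`, then `p ^ (r N)` dividing `s ^ N p ^ e c`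
bounds the denominators of `s / p ^ r`. -/
theorem pow_dvd_mul_pow_div {S : Type*} [CommRing S] [IsDomain S] [IsNoetherianRing S] {π : S}
    (hπ : Prime π) {q r m N e : ℕ} (hN : 0 < N) (hq : 0 < q) (he : q * e = N * m) {s c : S}
    (hc : ¬ π ∣ c)
    (h : π ^ (r * N) ∣ s ^ N * π ^ e * c) : π ^ r ∣ s * π ^ (m / q) := by
  by_cases hs : s = 0
  · simp [hs]
  obtain ⟨s', hs1, hs'⟩ :=
    (FiniteMultiplicity.of_not_isUnit hπ.not_isUnit hs).exists_eq_pow_mul_and_not_dvd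
  generalize multiplicity π s = v at hs1
  subst hs1
  have hdvd : π ^ (r * N) ∣ π ^ (v * N + e) * (s' ^ N * c) := by
    convert h using 1
    rw [mul_pow, pow_add, pow_mul]
    ring
  have hle : r * N ≤ v * N + e := by
    by_contra! hlt
    obtain ⟨t, ht⟩ := Nat.exists_eq_add_of_lt hlt
    rw [ht, show v * N + e + t + 1 = (v * N + e) + (t + 1) by ring, pow_add,
      mul_dvd_mul_iff_left (pow_ne_zero _ hπ.ne_zero)] at hdvd
    have h1 := (dvd_pow_self π (Nat.succ_ne_zero t)).trans hdvd
    rcases hπ.dvd_or_dvd h1 with h2 | h2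
    · exact hs' (hπ.dvd_of_dvd_pow h2)
    · exact hc h2
  have hrv : r ≤ v + m / q := by
    by_contra! hlt
    have h1 : (v + m / q + 1) * N ≤ v * N + e := (Nat.mul_le_mul_right N hlt).trans hle
    have h2 : (m / q + 1) * N ≤ e := by nlinarith
    have h3 : q * ((m / q + 1) * N) ≤ N * m := he ▸ Nat.mul_le_mul_left q h2
    have h4 : m < q * (m / q + 1) := by
      have := Nat.lt_mul_div_succ m hq
      simpa using this
    nlinarith
  have : π ^ v * s' * π ^ (m / q) = π ^ (v + m / q) * s' := by rw [pow_add]; ring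
  rw [this]
  exact (pow_dvd_pow _ hrv).mul_right _

/-! ### Passing from powers of `ω` to powers of `ω - h` -/

section DualCoefficients

variable {S L K : Type*} [CommRing S] [Field L] [Algebra S L] [Field K] [Algebra L K] [Algebra S K]
  {p r : ℕ}

/-- The sum may run over all `k < p`: where `n - k` truncates, the binomial coefficient vanishes. -/
theorem pow_eq_sum_sub_pow {A : Type*} [CommRing A] (w η : A) (n : Fin p) :
    w ^ (n : ℕ) = ∑ k : Fin p, (η ^ ((n : ℕ) - k) * ((n : ℕ).choose k : A)) *
      (w - η) ^ (k : ℕ) := by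
  conv_lhs => rw [← sub_add_cancel w η, add_pow]
  rw [Fin.sum_univ_eq_sum_range (fun k => (η ^ ((n : ℕ) - k) * ((n : ℕ).choose k : A)) *
    (w - η) ^ k) p]
  rw [Finset.sum_subset (Finset.range_subset_range.mpr (Nat.succ_le_of_lt n.2))]
  · exact Finset.sum_congr rfl fun k _ => by ring
  · intro k _ hk
    rw [Nat.choose_eq_zero_of_lt (by simpa using hk)]
    simp

theorem prod_pow_eq_sum_prod_sub_pow {A : Type*} [CommRing A] (w η : Fin r → A)
    (j : Fin r → Fin p) :
    ∏ i, w i ^ (j i : ℕ) = ∑ k : Fin r → Fin p,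
      (∏ i, η i ^ ((j i : ℕ) - k i) * ((j i : ℕ).choose (k i) : A)) *
        ∏ i, (w i - η i) ^ (k i : ℕ) := by
  classical
  rw [Finset.prod_congr rfl fun i _ => pow_eq_sum_sub_pow (w i) (η i) (j i),
    Finset.prod_univ_sum, Fintype.piFinset_univ]
  exact Finset.sum_congr rfl fun k _ => Finset.prod_mul_distrib

/-- Up to the factor `[K : L]`, the coefficients of `x` with respect to the basis of monomials in
the `ω i - h i`. -/
noncomputable def shiftedCoeff (L : Type*) {S K : Type*} [CommRing S] [Field L] [Field K]
    [Algebra L K] [Algebra S K] {p r : ℕ} (ω : Fin r → K) (h : Fin r → S) (x : K)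
    (k : Fin r → Fin p) : L :=
  Algebra.trace L K (x * ∏ i, ∑ j : Fin p,
    (algebraMap S K (h i) ^ ((j : ℕ) - k i) * ((j : ℕ).choose (k i) : K)) * (ω i ^ (j : ℕ))⁻¹)

theorem shiftedCoeff_eq_sum [IsScalarTower S L K] (ω : Fin r → K) (h : Fin r → S) (x : K)
    (k : Fin r → Fin p) :
    shiftedCoeff L ω h x k = ∑ j : Fin r → Fin p,
      algebraMap S L (∏ i, h i ^ ((j i : ℕ) - k i) * ((j i : ℕ).choose (k i) : S)) *
        Algebra.trace L K (x * (∏ i, ω i ^ (j i : ℕ))⁻¹) := by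
  classical
  rw [shiftedCoeff, Finset.prod_univ_sum, Fintype.piFinset_univ, Finset.mul_sum, map_sum]
  refine Finset.sum_congr rfl fun j _ => ?_
  rw [← smul_eq_mul (algebraMap S L _), ← map_smul, Algebra.smul_def,
    ← IsScalarTower.algebraMap_apply, Finset.prod_mul_distrib, Finset.prod_inv_distrib, map_prod]
  simp only [map_mul, map_pow, map_natCast]
  congr 1
  ring

end DualCoefficients

theorem isIntegral_inv_pow_mul_prod {S K : Type*} [CommRing S] [Field K] [CharZero K]
    [Algebra S K] {p r : ℕ} {f : Fin r → S} {ω : Fin r → K} (hp : p.Prime)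
    (hω : ∀ i, ω i ^ p = algebraMap S K (f i)) {h : Fin r → S}
    (hh : ∀ i, f i - h i ^ p ∈ Ideal.span {(p : S) ^ 2}) (j : Fin r → ℕ) (k : ℕ)
    (hk : (p - 1) * k ≤ ∑ i, j i) :
    IsIntegral S (((p : K) ^ k)⁻¹ * ∏ i, (ω i - algebraMap S K (h i)) ^ j i) := by
  let Ω := AlgebraicClosure K
  have hp2 := hp.two_le
  have hpΩ : (p : Ω) ≠ 0 := by
    rw [← map_natCast (algebraMap K Ω)]
    exact (map_ne_zero _).mpr (Nat.cast_ne_zero.mpr hp.ne_zero)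
  obtain ⟨l, hl⟩ := IsAlgClosed.exists_pow_nat_eq (p : Ω) (n := p - 1) (by omega)
  have hl0 : l ≠ 0 := by
    rintro rfl
    rw [zero_pow (by omega)] at hl
    exact hpΩ hl.symm
  choose g hg using fun i => Ideal.mem_span_singleton.mp (hh i)
  rw [← isIntegral_algebraMap_iff (algebraMap K Ω).injective]
  -- Writing `p ^ k = l ^ ((p - 1) k)` distributes the denominator over the integral elements `(ω i
  -- - h i) / l`; the inequality on `k` leaves a nonnegative power of `l`.
  have heq : algebraMap K Ω (((p : K) ^ k)⁻¹ * ∏ i, (ω i - algebraMap S K (h i)) ^ j i) =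
      l ^ (∑ i, j i - (p - 1) * k) *
        ∏ i, ((algebraMap K Ω (ω i) - algebraMap S Ω (h i)) / l) ^ j i := by
    rw [map_mul, map_inv₀, map_pow, map_natCast, map_prod]
    simp only [map_pow, map_sub, div_pow, ← IsScalarTower.algebraMap_apply S K Ω]
    rw [Finset.prod_div_distrib, Finset.prod_pow_eq_pow_sum, pow_sub₀ l hl0 hk, pow_mul, hl]
    rw [mul_comm (l ^ _), mul_assoc, mul_div_cancel₀ _ (pow_ne_zero _ hl0)]
  rw [heq]
  refine ((isIntegral_of_pow_eq_natCast hp hl).pow _).mul (IsIntegral.prod _ fun i _ => ?_)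
  refine (isIntegral_sub_div hp hpΩ hl ?_ (hg i)).pow _
  rw [← map_pow, hω, ← IsScalarTower.algebraMap_apply]

/-! ### The integral basis of the tower -/

section Tower

variable {S L K : Type*} [CommRing S] [IsDomain S] [IsNoetherianRing S] [IsIntegrallyClosed S]
  [Field L] [Algebra S L] [IsFractionRing S L] [Field K] [Algebra L K] [Algebra S K]
  [IsScalarTower S L K] {p r : ℕ} {f : Fin r → S} {ω : Fin r → K}

omit [IsIntegrallyClosed S] in
theorem finrank_smul_eq_sum_shiftedCoeff [CharZero L] [FiniteDimensional L K] (hp : p.Prime)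
    (hf0 : ∀ i, f i ≠ 0)
    (hfu : ∀ i, ¬ IsUnit (f i)) (hsq : ∀ i, IsSquareFreeElement (f i)) (hf : IsClassOneTower p f)
    (hω : ∀ i, ω i ^ p = algebraMap S K (f i))
    (htop : IntermediateField.adjoin L (Set.range ω) = ⊤) (h : Fin r → S) (x : K) :
    (Module.finrank L K : L) • x = ∑ k : Fin r → Fin p,
      shiftedCoeff L ω h x k • ∏ i, (ω i - algebraMap S K (h i)) ^ (k i : ℕ) := by
  rw [finrank_smul_eq_sum_trace (L := L) hp hf0 hfu hsq hf hω htop]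
  simp only [shiftedCoeff_eq_sum, Finset.sum_smul]
  rw [Finset.sum_comm]
  refine Finset.sum_congr rfl fun j _ => ?_
  generalize Algebra.trace L K (x * (∏ i, ω i ^ (j i : ℕ))⁻¹) = t
  rw [prod_pow_eq_sum_prod_sub_pow ω (fun i => algebraMap S K (h i)) j, Finset.smul_sum]
  refine Finset.sum_congr rfl fun k _ => ?_
  rw [mul_comm (algebraMap S L _), mul_smul]
  congr 1
  rw [Algebra.smul_def, ← IsScalarTower.algebraMap_apply, map_prod]
  simp only [map_mul, map_pow, map_natCast]

theorem shiftedCoeff_mem_range [CharZero L] [FiniteDimensional L K] (hp : p.Prime)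
    (hf0 : ∀ i, f i ≠ 0) (hsq : ∀ i, IsSquareFreeElement (f i)) (hf : IsClassOneTower p f)
    (hω : ∀ i, ω i ^ p = algebraMap S K (f i)) (h : Fin r → S) {x : K} (hx : IsIntegral S x)
    (k : Fin r → Fin p) : shiftedCoeff L ω h x k ∈ (algebraMap S L).range := by
  rw [shiftedCoeff_eq_sum]
  exact sum_mem fun j _ => mul_mem ⟨_, rfl⟩ (trace_mul_inv_mem_range hp hf0 hsq hf hω hx j)

/-- Bounds the denominator at `p`: after division by `p ^ r = [K : L]`, the coefficient costs at
most `⌊∑ k_i / (p-1)⌋` powers of `p`. -/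
theorem pow_dvd_shiftedCoeff_mul [CharZero L] [FiniteDimensional L K] (hp : p.Prime)
    (hpS : Prime (p : S)) (hf0 : ∀ i, f i ≠ 0) (hsq : ∀ i, IsSquareFreeElement (f i))
    (hf : IsClassOneTower p f) (hω : ∀ i, ω i ^ p = algebraMap S K (f i)) {h : Fin r → S}
    (hh : ∀ i, f i - h i ^ p ∈ Ideal.span {(p : S) ^ 2}) {x : K} (hx : IsIntegral S x)
    (k : Fin r → Fin p) {s : S} (hs : algebraMap S L s = shiftedCoeff L ω h x k) :
    (p : S) ^ r ∣ s * (p : S) ^ ((∑ i, (k i : ℕ)) / (p - 1)) := by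
  let Ω := AlgebraicClosure K
  have hp2 := hp.two_le
  have hSL := IsFractionRing.injective S L
  have hSΩ : Function.Injective (algebraMap S Ω) := by
    rw [IsScalarTower.algebraMap_eq S L Ω]
    exact (algebraMap L Ω).injective.comp hSL
  have hpL : (p : L) ≠ 0 := Nat.cast_ne_zero.mpr hp.ne_zero
  have hpΩ : (p : Ω) ≠ 0 := by
    rw [← map_natCast (algebraMap L Ω)]
    exact (map_ne_zero _).mpr hpL
  obtain ⟨l, hl⟩ := IsAlgClosed.exists_pow_nat_eq (p : Ω) (n := p - 1) (by omega)
  let θ : Fin r → Ω := fun i => algebraMap K Ω (ω i)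
  have hθ : ∀ i, θ i ^ p = algebraMap S Ω (f i) := fun i => by
    rw [← map_pow, hω, ← IsScalarTower.algebraMap_apply]
  choose g hg using fun i => Ideal.mem_span_singleton.mp (hh i)
  have hint := isIntegral_algebraMap_trace_mul (L := L) (Ω := Ω)
    (β := ∏ i, ∑ j : Fin p, (algebraMap S K (h i) ^ ((j : ℕ) - k i) * ((j : ℕ).choose (k i) : K)) *
      (ω i ^ (j : ℕ))⁻¹)
    (θ := ∏ i, (l ^ (k i : ℕ) * θ i ^ (p - 1) / p)) hx (fun σ => by
      rw [map_prod, ← Finset.prod_mul_distrib]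
      refine IsIntegral.prod _ fun i _ => ?_
      simp only [map_sum, map_mul, map_pow, map_natCast, map_inv₀]
      have hση : σ (algebraMap S K (h i)) = algebraMap S Ω (h i) :=
        (σ.restrictScalars S).commutes _
      rw [hση]
      refine isIntegral_sum_choose_mul_inv hp hpΩ hl ?_ ?_ (hg i) (hθ i) (k i)
      · exact (map_ne_zero_iff _ hSΩ).mpr (hf0 i)
      · rw [← map_pow, hω]
        exact (σ.restrictScalars S).commutes _)
  change IsIntegral S (algebraMap L Ω (shiftedCoeff L ω h x k) * _) at hint
  rw [← hs] at hint
  have hint' : IsIntegral S (algebraMap L Ω (algebraMap S L s / p ^ r) *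
      ∏ i, (l ^ (k i : ℕ) * θ i ^ (p - 1))) := by
    rw [map_div₀, map_pow, map_natCast]
    rw [Finset.prod_div_distrib, Finset.prod_const, Finset.card_univ, Fintype.card_fin] at hint
    convert hint using 1
    ring
  -- The exponent `p - 1` turns `l` into `p`, and `p` turns each `θ i` into `f i`, so the `N`-th
  -- power descends to `S`.
  set N := (p - 1) * p with hN
  have hpow : (∏ i, (l ^ (k i : ℕ) * θ i ^ (p - 1))) ^ N = algebraMap S Ω
      ((p : S) ^ (p * ∑ i, (k i : ℕ)) * ∏ i, f i ^ ((p - 1) * (p - 1))) := by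
    rw [map_mul, map_pow, map_natCast, map_prod, Finset.mul_sum,
      ← Finset.prod_pow_eq_pow_sum, ← Finset.prod_mul_distrib, ← Finset.prod_pow]
    refine Finset.prod_congr rfl fun i _ => ?_
    rw [map_pow, ← hθ, ← hl, hN]
    ring
  obtain ⟨c, hc⟩ := pow_mul_mem_range_of_isIntegral hpow hint'
  have hdvd : s ^ N * (p : S) ^ (p * ∑ i, (k i : ℕ)) * ∏ i, f i ^ ((p - 1) * (p - 1)) =
      (p : S) ^ (r * N) * c := by
    apply hSL
    rw [map_mul _ _ c, hc, div_pow, ← pow_mul, mul_assoc, map_mul, map_pow, map_pow _ (p : S) (r * N),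
      map_natCast]
    field_simp
  refine pow_dvd_mul_pow_div hpS (N := N) (e := p * ∑ i, (k i : ℕ))
    (Nat.mul_pos (by omega) hp.pos) (by omega) (by rw [hN]; ring)
    (c := ∏ i, f i ^ ((p - 1) * (p - 1))) ?_ ⟨c, hdvd⟩
  intro hcon
  obtain ⟨i, -, hi⟩ := (hpS.dvd_finsetProd_iff _).mp hcon
  exact hf.not_dvd hp hpS hf0 hsq i (hpS.dvd_of_dvd_pow hi)

theorem exists_eq_sum_of_isIntegral [CharZero L] [FiniteDimensional L K] (hp : p.Prime)
    (hpS : Prime (p : S)) (hf0 : ∀ i, f i ≠ 0) (hfu : ∀ i, ¬ IsUnit (f i))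
    (hsq : ∀ i, IsSquareFreeElement (f i))
    (hf : IsClassOneTower p f) (hω : ∀ i, ω i ^ p = algebraMap S K (f i))
    (htop : IntermediateField.adjoin L (Set.range ω) = ⊤) {h : Fin r → S}
    (hh : ∀ i, f i - h i ^ p ∈ Ideal.span {(p : S) ^ 2}) {x : K} (hx : IsIntegral S x) :
    ∃ u : (Fin r → Fin p) → S, x = ∑ k, u k • (((p : K) ^ ((∑ i, (k i : ℕ)) / (p - 1)))⁻¹ *
      ∏ i, (ω i - algebraMap S K (h i)) ^ (k i : ℕ)) := by
  choose s hs using fun k : Fin r → Fin p => shiftedCoeff_mem_range (L := L) hp hf0 hsq hf hω h hx k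
  choose u hu using fun k => pow_dvd_shiftedCoeff_mul hp hpS hf0 hsq hf hω hh hx k (hs k)
  refine ⟨u, ?_⟩
  have hpL : (p : L) ≠ 0 := Nat.cast_ne_zero.mpr hp.ne_zero
  have hpK : (p : K) ≠ 0 := by
    rw [← map_natCast (algebraMap L K)]
    exact (map_ne_zero _).mpr hpL
  have hsum := finrank_smul_eq_sum_shiftedCoeff (L := L) hp hf0 hfu hsq hf hω htop h x
  rw [finrank_eq_pow (L := L) hp hf0 hfu hsq hf hω htop, Algebra.smul_def, map_natCast,
    Nat.cast_pow] at hsum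
  apply mul_left_cancel₀ (pow_ne_zero r hpK)
  rw [hsum, Finset.mul_sum]
  refine Finset.sum_congr rfl fun k _ => ?_
  have hk := congrArg (algebraMap S K) (hu k)
  rw [map_mul, map_mul, map_pow, map_pow, map_natCast] at hk
  rw [← hs, Algebra.smul_def, Algebra.smul_def, ← IsScalarTower.algebraMap_apply]
  field_simp
  linear_combination (∏ i, (ω i - algebraMap S K (h i)) ^ (k i : ℕ)) * hk

/-- The integral closure is finite free over `S`, with basis the elements
`p ^ (-⌊(∑ kᵢ) / (p - 1)⌋) * ∏ (ωᵢ - hᵢ) ^ kᵢ`. -/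
theorem free_and_finite_integralClosure [CharZero L] [FiniteDimensional L K] (hp : p.Prime)
    (hpS : Prime (p : S)) (hf0 : ∀ i, f i ≠ 0) (hfu : ∀ i, ¬ IsUnit (f i))
    (hsq : ∀ i, IsSquareFreeElement (f i))
    (hf : IsClassOneTower p f) (hω : ∀ i, ω i ^ p = algebraMap S K (f i))
    (htop : IntermediateField.adjoin L (Set.range ω) = ⊤) :
    Module.Free S (integralClosure S K) ∧ Module.Finite S (integralClosure S K) := by
  have hK0 : CharZero K := charZero_of_injective_algebraMap (algebraMap L K).injective
  choose h hh using hf.isPow_mod_sq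
  let b : (Fin r → Fin p) → integralClosure S K := fun k =>
    ⟨((p : K) ^ ((∑ i, (k i : ℕ)) / (p - 1)))⁻¹ * ∏ i, (ω i - algebraMap S K (h i)) ^ (k i : ℕ),
      isIntegral_inv_pow_mul_prod hp hω hh _ _ (Nat.mul_div_le _ _)⟩
  have hspan : ⊤ ≤ Submodule.span S (Set.range b) := by
    rintro ⟨x, hx⟩ -
    obtain ⟨u, hu⟩ := exists_eq_sum_of_isIntegral (L := L) hp hpS hf0 hfu hsq hf hω htop hh hx
    rw [Submodule.mem_span_range_iff_exists_fun]
    refine ⟨u, Subtype.ext ?_⟩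
    rw [AddSubmonoidClass.coe_finsetSum]
    exact hu.symm
  -- By counting: the monomials in `ω` are integral, so the `p ^ r` elements `b k` span `K` over
  -- `L`.
  have hli : LinearIndependent L fun k => (b k : K) := by
    refine linearIndependent_of_top_le_span_of_card_eq_finrank ?_ ?_
    · rw [← span_range_prod_pow_eq_top (L := L) hp hω htop, Submodule.span_le]
      rintro _ ⟨j, rfl⟩
      have hint : IsIntegral S (∏ i, ω i ^ (j i : ℕ)) := by
        refine IsIntegral.prod _ fun i _ => IsIntegral.pow (IsIntegral.of_pow hp.pos ?_) _
        rw [hω]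
        exact isIntegral_algebraMap
      obtain ⟨u, hu⟩ := exists_eq_sum_of_isIntegral (L := L) hp hpS hf0 hfu hsq hf hω htop hh hint
      change ∏ i, ω i ^ (j i : ℕ) ∈ _
      rw [hu]
      refine sum_mem fun k _ => ?_
      rw [← algebraMap_smul L (u k)]
      exact Submodule.smul_mem _ _ (Submodule.subset_span ⟨k, rfl⟩)
    · rw [finrank_eq_pow (L := L) hp hf0 hfu hsq hf hω htop]
      simp
  have hinj : Function.Injective fun a : S => a • (1 : L) := by
    intro a a' haa
    simp only [Algebra.smul_def, mul_one] at haa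
    exact IsFractionRing.injective S L haa
  have hli' : LinearIndependent S b :=
    LinearIndependent.of_comp (integralClosure S K).val.toLinearMap (hli.restrict_scalars hinj)
  let B := Module.Basis.mk hli' hspan
  exact ⟨Module.Free.of_basis B, Module.Finite.of_basis B⟩

end Tower

/-! ### The main theorem -/

section Main

/-- In characteristic `p` the element `p` is zero, and in another positive characteristic it is a
unit. -/
theorem charZero_of_prime_natCast {S : Type*} [CommRing S] [IsDomain S] {p : ℕ} (hp : p.Prime)
    (hpS : Prime (p : S)) : CharZero S := by
  obtain ⟨q, hq⟩ := CharP.exists S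
  rcases CharP.char_is_prime_or_zero S q with hqp | rfl
  · exfalso
    by_cases hqp' : q = p
    · subst hqp'
      exact hpS.ne_zero (CharP.cast_eq_zero S q)
    · have hcop : IsCoprime (p : ℤ) (q : ℤ) :=
        Nat.isCoprime_iff_coprime.mpr ((Nat.coprime_primes hp hqp).mpr (Ne.symm hqp'))
      obtain ⟨a, b, hab⟩ := hcop
      have := congrArg (Int.cast : ℤ → S) hab
      push_cast at this
      rw [CharP.cast_eq_zero S q, mul_zero, add_zero, mul_comm] at this
      exact hpS.not_isUnit (.of_mul_eq_one _ this)
  · exact CharP.charP_to_charZero S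

theorem theorem3p4 {S L E : Type*} [CommRing S] [IsDomain S] [IsNoetherianRing S]
    [IsIntegrallyClosed S] [Field L] [Algebra S L] [IsFractionRing S L]
    [Field E] [Algebra L E] [Algebra S E] [IsScalarTower S L E]
    (p : ℕ) (hp : p.Prime) (hpS : Prime (p : S))
    {r : ℕ} (f : Fin r → S) (hf_ne_zero : ∀ i, f i ≠ 0) (hf_not_unit : ∀ i, ¬ IsUnit (f i))
    (hf_sqfree : ∀ i, IsSquareFreeElement (f i)) (hf : IsClassOneTower p f)
    (ω : Fin r → E) (hω : ∀ i, ω i ^ p = algebraMap S E (f i)) :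
    Module.Free S (integralClosure S (radicalTower L ω)) ∧
    (Odd p → ∀ h : Fin r → S, (∀ i, f i - h i ^ p ∈ Ideal.span {(p : S) ^ 2}) →
      Subalgebra.toSubmodule (integralClosure S (radicalTower L ω)) =
        Submodule.span S (radicalTowerGenerators S L p ω h)) ∧
    (IsCohenMacaulayRing S ∨ IsUnramifiedRegularLocalRing S p →
      IsCohenMacaulayRing (integralClosure S (radicalTower L ω))) := by
  have hS0 : CharZero S := charZero_of_prime_natCast hp hpS
  have hL0 : CharZero L := charZero_of_injective_algebraMap (IsFractionRing.injective S L)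
  have hK0 : CharZero (radicalTower L ω) :=
    charZero_of_injective_algebraMap (algebraMap L (radicalTower L ω)).injective
  let w : Fin r → radicalTower L ω := radicalTowerRoot L ω
  have hw : ∀ i, w i ^ p = algebraMap S (radicalTower L ω) (f i) := fun i => Subtype.ext (by
    change ω i ^ p = ((algebraMap S (radicalTower L ω) (f i) : radicalTower L ω) : E)
    rw [hω, IsScalarTower.algebraMap_apply S L E, IsScalarTower.algebraMap_apply S L (radicalTower L ω)]
    rfl)
  have hintω : ∀ x ∈ Set.range ω, IsIntegral L x := by
    rintro _ ⟨i, rfl⟩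
    refine IsIntegral.of_pow hp.pos ?_
    rw [hω, IsScalarTower.algebraMap_apply S L E]
    exact isIntegral_algebraMap
  have hfd : FiniteDimensional L (radicalTower L ω) :=
    IntermediateField.finiteDimensional_adjoin hintω
  have htop : IntermediateField.adjoin L (Set.range w) = ⊤ := by
    have hrange : Set.range ω = (radicalTower L ω).val '' Set.range w := by
      rw [← Set.range_comp]; rfl
    apply IntermediateField.map_injective (radicalTower L ω).val
    rw [IntermediateField.adjoin_map, ← hrange, ← AlgHom.fieldRange_eq_map,
      IntermediateField.fieldRange_val]
  obtain ⟨hfree, hfin⟩ := free_and_finite_integralClosure (L := L) hp hpS hf_ne_zero hf_not_unit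
    hf_sqfree hf hw htop
  refine ⟨hfree, fun _ h hh => ?_, fun hCM => ?_⟩
  · have hp2 := hp.two_le
    refine le_antisymm (fun x hx => ?_) (Submodule.span_le.mpr ?_)
    · obtain ⟨u, hu⟩ := exists_eq_sum_of_isIntegral (L := L) hp hpS hf_ne_zero hf_not_unit
        hf_sqfree hf hw htop hh hx
      rw [hu]
      refine sum_mem fun k _ => Submodule.smul_mem _ _ (Submodule.subset_span
        ⟨fun i => k i, (∑ i, (k i : ℕ)) / (p - 1), fun i => Nat.le_sub_one_of_lt (k i).2,
          Nat.mul_div_le _ _, Nat.lt_mul_div_succ _ (by omega), ?_⟩)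
      simp only [← IsScalarTower.algebraMap_apply S L (radicalTower L ω)]
      rfl
    · rintro _ ⟨j, k, -, hk, -, rfl⟩
      simp only [← IsScalarTower.algebraMap_apply S L (radicalTower L ω)]
      exact isIntegral_inv_pow_mul_prod hp hw hh j k hk
  · have hnoeth : IsNoetherianRing (integralClosure S (radicalTower L ω)) :=
      IsNoetherianRing.of_finite S _
    have hS : IsCohenMacaulayRing S := by
      rcases hCM with hCM | hreg
      · exact hCM
      · have := hreg.toIsRegularLocalRing
        exact IsRegularLocalRing.isCohenMacaulayRing
    exact IsCohenMacaulayRing.of_flat_of_isIntegral (S := S) fun m _ => hS.localization_maximal m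

end Main
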